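/- For $n\in\mathbb N$ let $P_n$ be the lattice of partitions of an $n$-element set, ordered by refinement ($x\le y$ if every block of $x$ is contained in a block of $y$), with join $+$, meet $\cdot$, least element $0$ (all blocks singletons), greatest element $1$ (a single block), and metric $$d(x,y)=\frac{\#x+\#y-2\,\#(x+y)}{n-1},$$ where $\#x$ is the number of blocks of $x$ (for $n\le 1$, $P_n$ is a single point). For a non-principal ultrafilter $\mathcal U$ on $\mathbb N$ let $P=\prod_{\mathcal U}P_n$ be the metric ultraproduct: the set of sequences $(x_n)$ with $x_n\in P_n$, with two sequences identified when $\lim_{n\to\mathcal U}d(x_n,y_n)=0$, with the metric $d([x_n],[y_n])=\lim_{n\to\mathcal U}d(x_n,y_n)$ and the join $[x_n]+[y_n]=[x_n+y_n]$. With the order $x\le y\Leftrightarrow x+y=y$, $P$ is a lattice with least element $0=[0]$ and greatest element $1=[1]$, the meet $xy$ being the greatest lower bound. Put $|x|=d(x,0)$. An element $x\in P$ is metrically modular if $|x+y|+|xy|=|x|+|y|$ for all $y\in P$. A partition is singular if at most one of its blocks has two or more elements, and a sublattice of $P_n$ is singular if all its elements are singular partitions. **Proposition.** Let $\mathcal U$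 be a non-principal ultrafilter on $\mathbb N$, and for each $n$ let $A_n\subseteq P_n$ be a sublattice which is maximal among the singular sublattices of $P_n$, or maximal among the distributive singular sublattices of $P_n$. Let $\prod_{\mathcal U}A_n\subseteq P$ be the set of elements represented by a sequence $(x_n)$ with $x_n\in A_n$ for all $n$. Then $\prod_{\mathcal U}A_n$ is a Boolean sublattice of $P$, that is, it contains $0$ and $1$, is closed under the join and the meet of $P$, is distributive, and each of its elements has a complement in it. Moreover, $\prod_{\mathcal U}A_n$ is equal to the set of metrically modular elements of $P$. -/

import Mathlib

open Filter Topology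

noncomputable section

/-- The lattice `P_n` of partitions of an `n`-element set, a partition being given by the equivalence
relation whose classes are its blocks. `x ≤ y` means that `x` refines `y`; `⊥` is the partition into
singletons and `⊤` the partition with a single block. -/
def PartitionLattice (n : ℕ) : Type := Setoid (Fin n)

namespace PartitionLattice

variable {n : ℕ}

instance : Lattice (PartitionLattice n) := inferInstanceAs (Lattice (Setoid (Fin n)))

instance : BoundedOrder (PartitionLattice n) := inferInstanceAs (BoundedOrder (Setoid (Fin n)))

/-- The set of blocks of a partition. -/
def blocks (x : PartitionLattice n) : Set (Set (Fin n)) := Setoid.classes (x : Setoid (Fin n))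

/-- The number `#x` of blocks of a partition. -/
def numBlocks (x : PartitionLattice n) : ℕ := x.blocks.ncard

/-- A partition is singular if at most one of its blocks has two or more elements. -/
def IsSingular (x : PartitionLattice n) : Prop := {B ∈ x.blocks | 2 ≤ B.ncard}.ncard ≤ 1

/-- Functions that are constant on the blocks of a partition (used only to verify the metric axioms). -/
def blockFun (x : PartitionLattice n) : Submodule ℝ (Fin n → ℝ) where
  carrier := {f | (x : Setoid (Fin n)) ≤ Setoid.ker f}
  add_mem' := fun {f g} hf hg i j h => by
    have h1 : f i = f j := hf h
    have h2 : g i = g j := hg h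
    change f i + g i = f j + g j
    rw [h1, h2]
  zero_mem' := fun _ _ _ => rfl
  smul_mem' := fun c f hf i j h => by
    have h1 : f i = f j := hf h
    change c * f i = c * f j
    rw [h1]

lemma mem_blockFun {x : PartitionLattice n} {f : Fin n → ℝ} :
    f ∈ blockFun x ↔ (x : Setoid (Fin n)) ≤ Setoid.ker f := Iff.rfl

lemma finrank_blockFun (x : PartitionLattice n) :
    Module.finrank ℝ (blockFun x) = x.numBlocks := by
  classical
  let s : Setoid (Fin n) := x
  have hr : LinearMap.range (LinearMap.funLeft ℝ ℝ (Quotient.mk s)) = blockFun x := by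
    ext f
    constructor
    · rintro ⟨g, rfl⟩ i j h
      exact congrArg g (Quotient.sound h)
    · intro hf
      exact ⟨Quotient.lift f (fun i j h => hf h), rfl⟩
  rw [← hr, LinearMap.finrank_range_of_inj
    (LinearMap.funLeft_injective_of_surjective ℝ ℝ _ Quotient.mk_surjective),
    Module.finrank_pi, numBlocks, blocks, ← Nat.card_coe_set_eq, ← Nat.card_eq_fintype_card]
  exact Nat.card_congr (Setoid.quotientEquivClasses s)

lemma blockFun_sup (x y : PartitionLattice n) : blockFun (x ⊔ y) = blockFun x ⊓ blockFun y := by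
  ext f
  exact sup_le_iff (α := Setoid (Fin n))

lemma blockFun_anti {x y : PartitionLattice n} (h : x ≤ y) : blockFun y ≤ blockFun x :=
  fun _ hf => le_trans (α := Setoid (Fin n)) h hf

lemma le_of_blockFun_le {x y : PartitionLattice n} (h : blockFun x ≤ blockFun y) : y ≤ x := by
  classical
  intro i j hij
  let s : Setoid (Fin n) := x
  have hf : (fun k => if s i k then (1 : ℝ) else 0) ∈ blockFun x := by
    intro a b hab
    have : s i a ↔ s i b := ⟨fun h' => s.trans' h' hab, fun h' => s.trans' h' (s.symm' hab)⟩
    change (if s i a then (1 : ℝ) else 0) = if s i b then 1 else 0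
    simp only [this]
  have h2 : (if s i i then (1 : ℝ) else 0) = if s i j then 1 else 0 := h hf hij
  by_contra hc
  have hc' : ¬ s i j := hc
  rw [if_pos (s.refl' i), if_neg hc'] at h2
  exact one_ne_zero h2

lemma numBlocks_anti {x y : PartitionLattice n} (h : x ≤ y) : y.numBlocks ≤ x.numBlocks := by
  rw [← finrank_blockFun, ← finrank_blockFun]
  exact Submodule.finrank_mono (blockFun_anti h)

lemma numBlocks_add_le {x a b : PartitionLattice n} (ha : x ≤ a) (hb : x ≤ b) :
    a.numBlocks + b.numBlocks ≤ x.numBlocks + (a ⊔ b).numBlocks := by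
  simp only [← finrank_blockFun]
  rw [← Submodule.finrank_sup_add_finrank_inf_eq, blockFun_sup]
  exact Nat.add_le_add_right
    (Submodule.finrank_mono (sup_le (blockFun_anti ha) (blockFun_anti hb))) _

lemma numBlocks_le (x : PartitionLattice n) : x.numBlocks ≤ n := by
  rw [← finrank_blockFun]
  simpa using Submodule.finrank_le (blockFun x)

lemma one_le_numBlocks (hn : 1 ≤ n) (x : PartitionLattice n) : 1 ≤ x.numBlocks :=
  (Set.ncard_pos (Set.toFinite _)).2 ⟨_, Setoid.mem_classes (x : Setoid (Fin n)) ⟨0, hn⟩⟩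

lemma eq_of_numBlocks {x y : PartitionLattice n} (h : x ≤ y) (h' : x.numBlocks ≤ y.numBlocks) :
    x = y := by
  refine le_antisymm h (le_of_blockFun_le ?_)
  rw [Submodule.eq_of_le_of_finrank_le (blockFun_anti h)]
  rwa [finrank_blockFun, finrank_blockFun]

lemma eq_of_lt_two (hn : n < 2) (x y : PartitionLattice n) : x = y := by
  have : Subsingleton (Fin n) := Fin.subsingleton_iff_le_one.2 (by omega)
  refine Setoid.ext fun a b => ?_
  have hab : a = b := Subsingleton.elim a b
  subst hab
  exact ⟨fun _ => Setoid.refl' (y : Setoid (Fin n)) a, fun _ => Setoid.refl' (x : Setoid (Fin n)) a⟩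

/-- The metric `d(x, y) = (#x + #y - 2 #(x + y)) / (n - 1)`. -/
instance : Dist (PartitionLattice n) :=
  ⟨fun x y => ((x.numBlocks : ℝ) + y.numBlocks - 2 * (x ⊔ y).numBlocks) / ((n : ℝ) - 1)⟩

lemma dist_def (x y : PartitionLattice n) :
    dist x y = ((x.numBlocks : ℝ) + y.numBlocks - 2 * (x ⊔ y).numBlocks) / ((n : ℝ) - 1) := rfl

lemma dist_same (x : PartitionLattice n) : dist x x = 0 := by
  rw [dist_def, sup_idem]
  ring

lemma sub_one_pos (hn : 2 ≤ n) : (0 : ℝ) < (n : ℝ) - 1 := by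
  have : (2 : ℝ) ≤ n := by exact_mod_cast hn
  linarith

instance : MetricSpace (PartitionLattice n) where
  dist_self := dist_same
  dist_comm x y := by rw [dist_def, dist_def, sup_comm]; ring
  dist_triangle x y z := by
    rcases lt_or_ge n 2 with hn | hn
    · rw [eq_of_lt_two hn y x, eq_of_lt_two hn z x, dist_same]; simp
    · have h1 := numBlocks_add_le (le_sup_right : y ≤ x ⊔ y) (le_sup_left : y ≤ y ⊔ z)
      have h2 : (x ⊔ y ⊔ (y ⊔ z)).numBlocks ≤ (x ⊔ z).numBlocks :=
        numBlocks_anti (sup_le (le_sup_left.trans le_sup_left) (le_sup_right.trans le_sup_right))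
      have h3 : ((x ⊔ y).numBlocks : ℝ) + (y ⊔ z).numBlocks ≤ y.numBlocks + (x ⊔ z).numBlocks := by
        exact_mod_cast h1.trans (by omega)
      rw [dist_def, dist_def, dist_def, ← add_div]
      exact div_le_div_of_nonneg_right (by linarith) (sub_one_pos hn).le
  eq_of_dist_eq_zero := fun {x y} h => by
    rcases lt_or_ge n 2 with hn | hn
    · exact eq_of_lt_two hn x y
    · rw [dist_def, div_eq_zero_iff, or_iff_left (sub_one_pos hn).ne'] at h
      have h1 := numBlocks_anti (le_sup_left : x ≤ x ⊔ y)
      have h2 := numBlocks_anti (le_sup_right : y ≤ x ⊔ y)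
      have h3 : x.numBlocks + y.numBlocks = 2 * (x ⊔ y).numBlocks := by
        have : (x.numBlocks : ℝ) + y.numBlocks = 2 * (x ⊔ y).numBlocks := by linarith
        exact_mod_cast this
      rw [eq_of_numBlocks (le_sup_left : x ≤ x ⊔ y) (by omega)]
      exact (eq_of_numBlocks (le_sup_right : y ≤ x ⊔ y) (by omega)).symm

lemma dist_le_one (x y : PartitionLattice n) : dist x y ≤ 1 := by
  rcases lt_or_ge n 2 with hn | hn
  · rw [eq_of_lt_two hn y x, dist_self]; exact zero_le_one
  · rw [dist_def, div_le_one (sub_one_pos hn)]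
    have h1 := numBlocks_add_le (bot_le : ⊥ ≤ x) (bot_le : ⊥ ≤ y)
    have h2 := numBlocks_le (⊥ : PartitionLattice n)
    have h3 := one_le_numBlocks (by omega) (x ⊔ y)
    have h4 : x.numBlocks + y.numBlocks + 1 ≤ n + 2 * (x ⊔ y).numBlocks := by omega
    have h5 : (x.numBlocks : ℝ) + y.numBlocks + 1 ≤ n + 2 * (x ⊔ y).numBlocks := by
      exact_mod_cast h4
    linarith

lemma dist_sup_sup_le (x y z : PartitionLattice n) : dist (x ⊔ z) (y ⊔ z) ≤ dist x y := by
  rcases lt_or_ge n 2 with hn | hn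
  · rw [eq_of_lt_two hn y x, dist_self, dist_self]
  · have h1 := numBlocks_add_le (le_sup_left : x ≤ x ⊔ z) (le_sup_left : x ≤ x ⊔ y)
    have h2 := numBlocks_add_le (le_sup_left : y ≤ y ⊔ z) (le_sup_right : y ≤ x ⊔ y)
    rw [show x ⊔ z ⊔ (x ⊔ y) = x ⊔ z ⊔ (y ⊔ z) by
      apply le_antisymm <;> simp only [sup_le_iff] <;> simp [le_sup_of_le_left, le_sup_of_le_right]] at h1
    rw [show y ⊔ z ⊔ (x ⊔ y) = x ⊔ z ⊔ (y ⊔ z) by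
      apply le_antisymm <;> simp only [sup_le_iff] <;> simp [le_sup_of_le_left, le_sup_of_le_right]] at h2
    have h3 : ((x ⊔ z).numBlocks : ℝ) + (x ⊔ y).numBlocks
        ≤ x.numBlocks + (x ⊔ z ⊔ (y ⊔ z)).numBlocks := by exact_mod_cast h1
    have h4 : ((y ⊔ z).numBlocks : ℝ) + (x ⊔ y).numBlocks
        ≤ y.numBlocks + (x ⊔ z ⊔ (y ⊔ z)).numBlocks := by exact_mod_cast h2
    rw [dist_def, dist_def]
    exact div_le_div_of_nonneg_right (by linarith) (sub_one_pos hn).le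

lemma dist_sup_eq (x y : PartitionLattice n) :
    dist x (x ⊔ y) = dist (x ⊔ y) ⊥ - dist x ⊥ := by
  simp only [dist_def, sup_bot_eq, sup_left_idem]
  ring

end PartitionLattice

/-- Sequences `(x_n)` with `x_n ∈ P_n`, with the pseudometric `d(x, y) = lim_𝒰 d(x_n, y_n)`. -/
def PreUltraproduct (_𝒰 : Ultrafilter ℕ) : Type := ∀ n, PartitionLattice n

namespace PreUltraproduct

variable {𝒰 : Ultrafilter ℕ}

instance : Dist (PreUltraproduct 𝒰) :=
  ⟨fun x y => limUnder (𝒰 : Filter ℕ) (fun n => dist (x n) (y n))⟩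

lemma tendsto_dist (x y : PreUltraproduct 𝒰) :
    Tendsto (fun n => dist (x n) (y n)) 𝒰 (𝓝 (dist x y)) := by
  have h : ∃ a : ℝ, Tendsto (fun n => dist (x n) (y n)) 𝒰 (𝓝 a) := by
    obtain ⟨a, -, ha⟩ := (isCompact_Icc (a := (0 : ℝ)) (b := 1)).ultrafilter_le_nhds
      (𝒰.map (fun n => dist (x n) (y n))) (by
        rw [le_principal_iff, Ultrafilter.coe_map, mem_map]
        exact Filter.univ_mem'
          (fun n => ⟨dist_nonneg, PartitionLattice.dist_le_one (x n) (y n)⟩))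
    exact ⟨a, ha⟩
  exact tendsto_nhds_limUnder h

instance : PseudoMetricSpace (PreUltraproduct 𝒰) where
  dist_self x := tendsto_nhds_unique (tendsto_dist x x) (by simp)
  dist_comm x y := tendsto_nhds_unique (tendsto_dist x y) (by simpa only [dist_comm] using tendsto_dist y x)
  dist_triangle x y z := le_of_tendsto_of_tendsto' (tendsto_dist x z)
    ((tendsto_dist x y).add (tendsto_dist y z)) (fun n => dist_triangle _ _ _)

/-- The termwise join of two sequences. -/
def join (x y : PreUltraproduct 𝒰) : PreUltraproduct 𝒰 := fun n => x n ⊔ y n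

lemma dist_join_join_le (x y z w : PreUltraproduct 𝒰) :
    dist (join x z) (join y w) ≤ dist x y + dist z w := by
  refine le_of_tendsto_of_tendsto' (tendsto_dist _ _)
    ((tendsto_dist x y).add (tendsto_dist z w)) (fun n => ?_)
  refine (dist_triangle _ (y n ⊔ z n) _).trans (add_le_add (PartitionLattice.dist_sup_sup_le _ _ _) ?_)
  change dist (y n ⊔ z n) (y n ⊔ w n) ≤ _
  rw [sup_comm (y n), sup_comm (y n)]
  exact PartitionLattice.dist_sup_sup_le _ _ _

end PreUltraproduct

/-- The metric ultraproduct `∏_𝒰 P_n`: the metric quotient of the space of sequences `(x_n)`,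
`x_n ∈ P_n`, by the pseudometric `lim_𝒰 d(x_n, y_n)`. -/
def Ultraproduct (𝒰 : Ultrafilter ℕ) : Type := SeparationQuotient (PreUltraproduct 𝒰)

namespace Ultraproduct

variable {𝒰 : Ultrafilter ℕ}

instance : MetricSpace (Ultraproduct 𝒰) :=
  inferInstanceAs (MetricSpace (SeparationQuotient (PreUltraproduct 𝒰)))

/-- The element of the ultraproduct represented by a sequence. -/
def mk (𝒰 : Ultrafilter ℕ) (x : ∀ n, PartitionLattice n) : Ultraproduct 𝒰 :=
  SeparationQuotient.mk (X := PreUltraproduct 𝒰) x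

lemma mk_surjective (p : Ultraproduct 𝒰) : ∃ x, mk 𝒰 x = p := SeparationQuotient.surjective_mk p

lemma tendsto_dist (x y : ∀ n, PartitionLattice n) :
    Tendsto (fun n => dist (x n) (y n)) 𝒰 (𝓝 (dist (mk 𝒰 x) (mk 𝒰 y))) :=
  PreUltraproduct.tendsto_dist (𝒰 := 𝒰) x y

lemma mk_eq_mk {x y : ∀ n, PartitionLattice n} (h : Tendsto (fun n => dist (x n) (y n)) 𝒰 (𝓝 0)) :
    mk 𝒰 x = mk 𝒰 y :=
  dist_eq_zero.1 (tendsto_nhds_unique (tendsto_dist x y) h)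

/-- The join of the ultraproduct: `[x_n] + [y_n] = [x_n + y_n]`. -/
def join : Ultraproduct 𝒰 → Ultraproduct 𝒰 → Ultraproduct 𝒰 :=
  SeparationQuotient.lift₂ (fun x y : PreUltraproduct 𝒰 => mk 𝒰 (fun n => x n ⊔ y n)) (by
    intro x z y w hxy hzw
    rw [Metric.inseparable_iff] at hxy hzw
    refine dist_eq_zero.1 (le_antisymm ?_ dist_nonneg)
    refine (PreUltraproduct.dist_join_join_le x y z w).trans ?_
    rw [hxy, hzw, add_zero])

lemma join_mk (x y : ∀ n, PartitionLattice n) : join (mk 𝒰 x) (mk 𝒰 y) = mk 𝒰 (fun n => x n ⊔ y n) := rfl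

/-- The order of the ultraproduct: `x ≤ y` if and only if `x + y = y`. -/
instance : SemilatticeSup (Ultraproduct 𝒰) :=
  @SemilatticeSup.mk' _ ⟨join⟩
    (by
      intro a b
      obtain ⟨x, rfl⟩ := mk_surjective a
      obtain ⟨y, rfl⟩ := mk_surjective b
      change join _ _ = join _ _
      simp only [join_mk, sup_comm])
    (by
      intro a b c
      obtain ⟨x, rfl⟩ := mk_surjective a
      obtain ⟨y, rfl⟩ := mk_surjective b
      obtain ⟨z, rfl⟩ := mk_surjective c
      change join (join _ _) _ = join _ (join _ _)
      simp only [join_mk, sup_assoc])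
    (by
      intro a
      obtain ⟨x, rfl⟩ := mk_surjective a
      change join _ _ = _
      simp only [join_mk, sup_idem])

lemma mk_sup (x y : ∀ n, PartitionLattice n) : mk 𝒰 x ⊔ mk 𝒰 y = mk 𝒰 (fun n => x n ⊔ y n) := rfl

instance : BoundedOrder (Ultraproduct 𝒰) where
  bot := mk 𝒰 (fun _ => ⊥)
  top := mk 𝒰 (fun _ => ⊤)
  bot_le a := by
    obtain ⟨x, rfl⟩ := mk_surjective a
    rw [← sup_eq_right]
    change mk 𝒰 _ = _
    simp
  le_top a := by
    obtain ⟨x, rfl⟩ := mk_surjective a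
    rw [← sup_eq_right]
    change mk 𝒰 _ = mk 𝒰 _
    simp

lemma mk_le_iff (x y : ∀ n, PartitionLattice n) :
    mk 𝒰 x ≤ mk 𝒰 y ↔ Tendsto (fun n => dist (x n ⊔ y n) (y n)) 𝒰 (𝓝 0) := by
  rw [← sup_eq_right, mk_sup]
  constructor
  · intro h
    have := tendsto_dist (𝒰 := 𝒰) (fun n => x n ⊔ y n) y
    rwa [h, dist_self] at this
  · exact mk_eq_mk

lemma dist_sup_eq (a b : Ultraproduct 𝒰) : dist a (a ⊔ b) = dist (a ⊔ b) ⊥ - dist a ⊥ := by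
  obtain ⟨x, rfl⟩ := mk_surjective a
  obtain ⟨y, rfl⟩ := mk_surjective b
  refine tendsto_nhds_unique (tendsto_dist x (fun n => x n ⊔ y n)) ?_
  simp only [PartitionLattice.dist_sup_eq]
  exact (tendsto_dist (𝒰 := 𝒰) (fun n => x n ⊔ y n) (fun _ => ⊥)).sub
    (tendsto_dist (𝒰 := 𝒰) x (fun _ => ⊥))

/-- Any two elements of the ultraproduct have a greatest lower bound. -/
theorem exists_isGLB (a b : Ultraproduct 𝒰) : ∃ c, IsGLB {a, b} c := by
  suffices h : ∃ c, c ≤ a ∧ c ≤ b ∧ ∀ w, w ≤ a → w ≤ b → dist w ⊥ ≤ dist c ⊥ by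
    obtain ⟨c, hca, hcb, hc⟩ := h
    refine ⟨c, by simp [hca, hcb], fun w hw => ?_⟩
    have hwa : w ≤ a := hw (by simp)
    have hwb : w ≤ b := hw (by simp)
    have h1 := hc (c ⊔ w) (sup_le hca hwa) (sup_le hcb hwb)
    have h2 := dist_sup_eq c w
    have h3 : dist c (c ⊔ w) = 0 := le_antisymm (by linarith) dist_nonneg
    rw [dist_eq_zero.1 h3]
    exact le_sup_right
  obtain ⟨x, rfl⟩ := mk_surjective a
  obtain ⟨y, rfl⟩ := mk_surjective b
  by_cases hU : (𝒰 : Filter ℕ) ≤ cofinite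
  · set S : Set ℝ := {r | ∃ w : Ultraproduct 𝒰, w ≤ mk 𝒰 x ∧ w ≤ mk 𝒰 y ∧ r = dist w ⊥} with hS
    have hne : S.Nonempty := ⟨_, ⊥, bot_le, bot_le, rfl⟩
    have hbd : BddAbove S := by
      refine ⟨1, ?_⟩
      rintro _ ⟨w, -, -, rfl⟩
      obtain ⟨z, rfl⟩ := mk_surjective w
      exact le_of_tendsto' (tendsto_dist z (fun _ => ⊥)) (fun n => PartitionLattice.dist_le_one _ _)
    have hk : ∀ k : ℕ, ∃ z : ∀ n, PartitionLattice n, mk 𝒰 z ≤ mk 𝒰 x ∧ mk 𝒰 z ≤ mk 𝒰 y ∧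
        sSup S - 1 / ((k : ℝ) + 1) < dist (mk 𝒰 z) ⊥ := by
      intro k
      have hpos : (0 : ℝ) < 1 / ((k : ℝ) + 1) := by positivity
      obtain ⟨_, ⟨w, h1, h2, rfl⟩, h3⟩ := exists_lt_of_lt_csSup hne (sub_lt_self (sSup S) hpos)
      obtain ⟨z, rfl⟩ := mk_surjective w
      exact ⟨z, h1, h2, h3⟩
    choose z hzx hzy hz using hk
    let G : ℕ → ℕ → Prop := fun n k => dist (z k n ⊔ x n) (x n) < 1 / ((k : ℝ) + 1) ∧
      dist (z k n ⊔ y n) (y n) < 1 / ((k : ℝ) + 1) ∧ sSup S - 1 / ((k : ℝ) + 1) < dist (z k n) ⊥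
    have hG : ∀ k, ∀ᶠ n in (𝒰 : Filter ℕ), G n k := by
      intro k
      have hpos : (0 : ℝ) < 1 / ((k : ℝ) + 1) := by positivity
      filter_upwards [((mk_le_iff _ _).1 (hzx k)).eventually (gt_mem_nhds hpos),
        ((mk_le_iff _ _).1 (hzy k)).eventually (gt_mem_nhds hpos),
        (tendsto_dist (𝒰 := 𝒰) (z k) (fun _ => ⊥)).eventually (lt_mem_nhds (hz k))] with n h1 h2 h3
      exact ⟨h1, h2, h3⟩
    classical
    let κ : ℕ → ℕ := fun n => Nat.findGreatest (G n) n
    have hκ : ∀ K, ∀ᶠ n in (𝒰 : Filter ℕ), K ≤ κ n ∧ G n (κ n) := by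
      intro K
      have hK : ∀ᶠ n in (𝒰 : Filter ℕ), K ≤ n :=
        hU (by rw [Nat.cofinite_eq_atTop]; exact eventually_ge_atTop K)
      filter_upwards [hK, hG K] with n h1 h2
      exact ⟨Nat.le_findGreatest h1 h2, Nat.findGreatest_spec h1 h2⟩
    have hinv : Tendsto (fun n => 1 / ((κ n : ℝ) + 1)) 𝒰 (𝓝 0) := by
      have : Tendsto κ 𝒰 atTop := tendsto_atTop.2 fun K => (hκ K).mono fun _ h => h.1
      exact tendsto_one_div_add_atTop_nhds_zero_nat.comp this
    refine ⟨mk 𝒰 (fun n => z (κ n) n), (mk_le_iff _ _).2 ?_, (mk_le_iff _ _).2 ?_, fun w h1 h2 => ?_⟩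
    · exact squeeze_zero' (Eventually.of_forall fun _ => dist_nonneg)
        ((hκ 0).mono fun n h => h.2.1.le) hinv
    · exact squeeze_zero' (Eventually.of_forall fun _ => dist_nonneg)
        ((hκ 0).mono fun n h => h.2.2.1.le) hinv
    · refine (le_csSup hbd ⟨w, h1, h2, rfl⟩).trans ?_
      have h3 : Tendsto (fun n => sSup S - 1 / ((κ n : ℝ) + 1)) 𝒰 (𝓝 (sSup S)) := by
        simpa using tendsto_const_nhds.sub hinv
      exact le_of_tendsto_of_tendsto h3 (tendsto_dist (fun n => z (κ n) n) (fun _ => ⊥))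
        ((hκ 0).mono fun n h => h.2.2.2.le)
  · obtain ⟨m, hm⟩ : ∃ m, 𝒰 = pure m := by
      have := 𝒰.le_cofinite_or_eq_pure.resolve_left hU
      obtain ⟨m, hm⟩ := this
      exact ⟨m, hm⟩
    subst hm
    have hd : ∀ u v : ∀ n, PartitionLattice n,
        dist (mk (pure m) u) (mk (pure m) v) = dist (u m) (v m) := fun u v =>
      tendsto_nhds_unique (tendsto_dist (𝒰 := pure m) u v) (by
        rw [Ultrafilter.coe_pure]; exact tendsto_pure_nhds _ _)
    have hle : ∀ u v : ∀ n, PartitionLattice n, mk (pure m) u ≤ mk (pure m) v ↔ u m ≤ v m := by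
      intro u v
      rw [← sup_eq_right, mk_sup, ← dist_eq_zero, hd, dist_eq_zero, sup_eq_right]
    refine ⟨mk (pure m) (fun n => x n ⊓ y n), (hle _ _).2 inf_le_left, (hle _ _).2 inf_le_right, ?_⟩
    intro w h1 h2
    obtain ⟨z, rfl⟩ := mk_surjective w
    rw [hle] at h1 h2
    have h3 := (hle z (fun n => x n ⊓ y n)).2 (le_inf h1 h2)
    have h4 := dist_sup_eq (mk (pure m) z) (mk (pure m) (fun n => x n ⊓ y n))
    rw [sup_eq_right.2 h3] at h4
    have h5 := dist_nonneg (x := mk (pure m) z) (y := mk (pure m) (fun n => x n ⊓ y n))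
    linarith

/-- The lattice structure of the ultraproduct; the meet is the greatest lower bound, which in general
is not represented by the sequence of meets. -/
instance : Lattice (Ultraproduct 𝒰) where
  inf a b := (exists_isGLB a b).choose
  inf_le_left a b := (exists_isGLB a b).choose_spec.1 (by simp)
  inf_le_right a b := (exists_isGLB a b).choose_spec.1 (by simp)
  le_inf a b c hb hc := (exists_isGLB b c).choose_spec.2 (by simp [hb, hc])

/-- The ultraproduct `∏_𝒰 A_n` of subsets `A_n ⊆ P_n`, as a subset of `∏_𝒰 P_n`: all elements
represented by a sequence `(x_n)` with `x_n ∈ A_n`. -/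
def ofSets (𝒰 : Ultrafilter ℕ) (A : ∀ n, Set (PartitionLattice n)) : Set (Ultraproduct 𝒰) :=
  {p | ∃ x : ∀ n, PartitionLattice n, (∀ n, x n ∈ A n) ∧ mk 𝒰 x = p}

end Ultraproduct

/-- `x` is metrically modular if `|x + y| + |x y| = |x| + |y|` for all `y`, where `|x| = d(x, 0)`. -/
def IsMetricallyModular {L : Type*} [Lattice L] [BoundedOrder L] [MetricSpace L] (x : L) : Prop :=
  ∀ y : L, dist (x ⊔ y) ⊥ + dist (x ⊓ y) ⊥ = dist x ⊥ + dist y ⊥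

/-- The distributive law holds for the elements of `S`. -/
def IsDistributiveOn {L : Type*} [Lattice L] (S : Set L) : Prop :=
  ∀ x ∈ S, ∀ y ∈ S, ∀ z ∈ S, x ⊓ (y ⊔ z) = x ⊓ y ⊔ x ⊓ z

/-- `S` is a Boolean sublattice of `L`: it contains `0` and `1`, is closed under joins and meets of
`L`, satisfies the distributive law, and each of its elements has a complement in `S`. -/
structure IsBooleanSublattice {L : Type*} [Lattice L] [BoundedOrder L] (S : Set L) : Prop where
  bot_mem : ⊥ ∈ S
  top_mem : ⊤ ∈ S
  sup_mem : ∀ x ∈ S, ∀ y ∈ S, x ⊔ y ∈ S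
  inf_mem : ∀ x ∈ S, ∀ y ∈ S, x ⊓ y ∈ S
  distrib : IsDistributiveOn S
  exists_compl : ∀ x ∈ S, ∃ y ∈ S, x ⊔ y = ⊤ ∧ x ⊓ y = ⊥

/-- A sublattice of `P_n` is singular if all its elements are singular partitions. -/
def IsSingularSublattice {n : ℕ} (A : Sublattice (PartitionLattice n)) : Prop :=
  ∀ x ∈ A, x.IsSingular

/-- A sublattice of `P_n` that is both singular and distributive. -/
def IsSingularDistributiveSublattice {n : ℕ} (A : Sublattice (PartitionLattice n)) : Prop :=
  IsSingularSublattice A ∧ IsDistributiveOn (A : Set (PartitionLattice n))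

end

/-! In `P_n` the number |x| = d(x, 0) is the normalised rank (n - #x)/(n - 1). The proof shows that
the ultraproduct of the `A n` and the set of metrically modular elements both consist of the
elements represented by sequences `singleBlock (S n)`.

One-block partitions s are modular: #(s + y) + #(s y) = #s + #y for every y
(`numBlocks_singleBlock_sup_add_inf`). So they represent metrically modular elements, and their
meets in P are termwise (`mk_singleBlock_inf`), which fails for meets in general. Adding boundedly
many points to S changes o(n) blocks, so S ↦ [`singleBlock S`] takes unions to joins even for
disjoint sets, and its range is Boolean (`isBooleanSublattice_range`).

In a singular sublattice any two non-trivial blocks meet. Either all of them share a point, or they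
generate a triangle of two-element blocks. By maximality, `A n` then contains every one-block
partition whose block includes a certain set K of at most three points
(`exists_forall_singleBlock_mem`), and passing from S to S ∪ K loses nothing in the limit.

Conversely, let [x] be metrically modular. Choose two points in each non-trivial block of x, forming
transversals T and U, and let y pair up most of these blocks twice, through T and through U. Then
[x][y] = 0, but the pairs in T alone already give x + y. Modularity forces |y| = |y T|, so the pairs
in U are negligible; hence |T| = o(n), and x is o(n) blocks away from a one-block partition
(`exists_of_isMetricallyModular`). -/

namespace PartitionLattice

variable {n : ℕ}

/-! ### Partitions with one non-trivial block -/

/-- Two points lie in the same block of a partition. -/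
def Rel (x : PartitionLattice n) (i j : Fin n) : Prop := Setoid.r (self := (x : Setoid (Fin n))) i j

lemma Rel.refl (x : PartitionLattice n) (i : Fin n) : x.Rel i i := Setoid.refl' (x : Setoid (Fin n)) i

lemma Rel.symm {x : PartitionLattice n} {i j : Fin n} (h : x.Rel i j) : x.Rel j i :=
  Setoid.symm' (x : Setoid (Fin n)) h

lemma Rel.trans {x : PartitionLattice n} {i j k : Fin n} (h : x.Rel i j) (h' : x.Rel j k) :
    x.Rel i k := Setoid.trans' (x : Setoid (Fin n)) h h'

lemma le_iff_rel {x y : PartitionLattice n} : x ≤ y ↔ ∀ i j, x.Rel i j → y.Rel i j :=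
  ⟨fun h _ _ hij => h hij, fun h i j hij => h i j hij⟩

lemma Rel.mono {x y : PartitionLattice n} (h : x ≤ y) {i j : Fin n} (hij : x.Rel i j) : y.Rel i j :=
  h hij

lemma ext_rel {x y : PartitionLattice n} (h : ∀ i j, x.Rel i j ↔ y.Rel i j) : x = y :=
  Setoid.ext h

lemma rel_inf {x y : PartitionLattice n} {i j : Fin n} : (x ⊓ y).Rel i j ↔ x.Rel i j ∧ y.Rel i j :=
  Iff.rfl

lemma rel_bot {i j : Fin n} : (⊥ : PartitionLattice n).Rel i j ↔ i = j := Iff.rfl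

lemma le_bot_iff_rel {x : PartitionLattice n} : x = ⊥ ↔ ∀ i j, x.Rel i j → i = j := by
  rw [← le_bot_iff, le_iff_rel]
  rfl

/-- The partition whose only block with possibly more than one element is `S`. -/
def singleBlock (S : Set (Fin n)) : PartitionLattice n :=
  (⟨fun i j => i = j ∨ i ∈ S ∧ j ∈ S, fun _ => Or.inl rfl,
    fun h => by tauto, fun {i j k} h h' => by
      rcases h with rfl | h
      · exact h'
      · rcases h' with rfl | h'
        · exact Or.inr h
        · exact Or.inr ⟨h.1, h'.2⟩⟩ : Setoid (Fin n))

lemma rel_singleBlock {S : Set (Fin n)} {i j : Fin n} :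
    (singleBlock S).Rel i j ↔ i = j ∨ i ∈ S ∧ j ∈ S := Iff.rfl

lemma singleBlock_mono {S T : Set (Fin n)} (h : S ⊆ T) : singleBlock S ≤ singleBlock T :=
  le_iff_rel.2 fun _ _ hij => hij.imp_right fun hij => ⟨h hij.1, h hij.2⟩

lemma singleBlock_le {S : Set (Fin n)} {x : PartitionLattice n} :
    singleBlock S ≤ x ↔ ∀ i ∈ S, ∀ j ∈ S, x.Rel i j := by
  rw [le_iff_rel]
  refine ⟨fun h i hi j hj => h i j (Or.inr ⟨hi, hj⟩), fun h i j hij => ?_⟩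
  rcases hij with rfl | ⟨hi, hj⟩
  · exact Rel.refl x i
  · exact h i hi j hj

lemma singleBlock_of_subsingleton {S : Set (Fin n)} (h : S.Subsingleton) : singleBlock S = ⊥ :=
  le_bot_iff.1 (singleBlock_le.2 fun _ hi _ hj => h hi hj)

lemma singleBlock_univ : singleBlock (Set.univ : Set (Fin n)) = ⊤ :=
  top_le_iff.1 (le_iff_rel.2 fun _ _ _ => Or.inr ⟨trivial, trivial⟩)

lemma singleBlock_inf (S T : Set (Fin n)) : singleBlock S ⊓ singleBlock T = singleBlock (S ∩ T) := by
  refine ext_rel fun i j => ?_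
  simp only [rel_inf, rel_singleBlock, Set.mem_inter_iff]
  tauto

lemma singleBlock_sup {S T : Set (Fin n)} (h : (S ∩ T).Nonempty) :
    singleBlock S ⊔ singleBlock T = singleBlock (S ∪ T) := by
  obtain ⟨p, hS, hT⟩ := h
  refine le_antisymm (sup_le (singleBlock_mono Set.subset_union_left)
    (singleBlock_mono Set.subset_union_right)) (singleBlock_le.2 ?_)
  have h : ∀ i ∈ S ∪ T, (singleBlock S ⊔ singleBlock T).Rel i p := by
    rintro i (hi | hi)
    · exact Rel.mono le_sup_left (rel_singleBlock.2 (Or.inr ⟨hi, hS⟩))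
    · exact Rel.mono le_sup_right (rel_singleBlock.2 (Or.inr ⟨hi, hT⟩))
  exact fun i hi j hj => (h i hi).trans (h j hj).symm

lemma mem_blocks {x : PartitionLattice n} {B : Set (Fin n)} :
    B ∈ x.blocks ↔ ∃ i, B = {j | x.Rel j i} := Iff.rfl

lemma isSingular_singleBlock (S : Set (Fin n)) : (singleBlock S).IsSingular := by
  refine (Set.ncard_le_ncard (t := {S}) ?_).trans (Set.ncard_singleton S).le
  rintro B ⟨hB, h2⟩
  obtain ⟨i, rfl⟩ := mem_blocks.1 hB
  obtain ⟨j, hj, hji⟩ := Set.exists_ne_of_one_lt_ncard h2 i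
  have hi : i ∈ S := ((rel_singleBlock.1 hj).resolve_left hji).2
  ext k
  simp only [Set.mem_ofPred_eq, rel_singleBlock]
  constructor
  · rintro (rfl | h)
    exacts [hi, h.1]
  · exact fun h => Or.inr ⟨h, hi⟩

lemma isSingular_iff {x : PartitionLattice n} : x.IsSingular ↔ ∃ S, x = singleBlock S := by
  refine ⟨fun h => ⟨⋃₀ {B ∈ x.blocks | 2 ≤ B.ncard}, ext_rel fun i j => ⟨fun hij => ?_, ?_⟩⟩, ?_⟩
  · rw [rel_singleBlock]
    refine or_iff_not_imp_left.2 fun hne => ?_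
    have hB : {k | x.Rel k i} ∈ {B ∈ x.blocks | 2 ≤ B.ncard} :=
      ⟨mem_blocks.2 ⟨i, rfl⟩, (Set.one_lt_ncard).2 ⟨i, Rel.refl x i, j, hij.symm, hne⟩⟩
    exact ⟨⟨_, hB, Rel.refl x i⟩, ⟨_, hB, hij.symm⟩⟩
  · rintro (rfl | ⟨⟨B, hB, hi⟩, C, hC, hj⟩)
    · exact Rel.refl x i
    · obtain rfl : B = C := (Set.ncard_le_one_iff (Set.toFinite _)).1 h hB hC
      obtain ⟨k, rfl⟩ := mem_blocks.1 hB.1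
      exact Rel.trans hi (Rel.symm hj)
  · rintro ⟨S, rfl⟩
    exact isSingular_singleBlock S

/-! ### Counting blocks -/

lemma numBlocks_eq_card_quotient (x : PartitionLattice n) :
    x.numBlocks = Nat.card (Quotient (x : Setoid (Fin n))) := by
  rw [numBlocks, blocks, ← Nat.card_coe_set_eq]
  exact (Nat.card_congr (Setoid.quotientEquivClasses (x : Setoid (Fin n)))).symm

/-- A set of points in different blocks gives a lower bound for the number of blocks. -/
lemma ncard_le_numBlocks {x : PartitionLattice n} {D : Set (Fin n)}
    (h : ∀ i ∈ D, ∀ j ∈ D, x.Rel i j → i = j) : D.ncard ≤ x.numBlocks := by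
  rw [numBlocks_eq_card_quotient, ← Nat.card_coe_set_eq]
  have : Finite (Quotient (x : Setoid (Fin n))) := Quotient.finite _
  exact Nat.card_le_card_of_injective
    (fun i : D => (Quotient.mk (x : Setoid (Fin n)) i : Quotient (x : Setoid (Fin n))))
    fun i j hij => Subtype.ext (h i i.2 j j.2 (Quotient.exact hij))

/-- A set of points meeting all blocks gives an upper bound for the number of blocks. -/
lemma numBlocks_le_ncard {x : PartitionLattice n} {D : Set (Fin n)}
    (h : ∀ i, ∃ j ∈ D, x.Rel j i) : x.numBlocks ≤ D.ncard := by
  rw [numBlocks_eq_card_quotient, ← Nat.card_coe_set_eq]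
  refine Nat.card_le_card_of_surjective
    (fun i : D => (Quotient.mk (x : Setoid (Fin n)) i : Quotient (x : Setoid (Fin n)))) fun q => ?_
  induction q using Quotient.inductionOn with
  | h i =>
    obtain ⟨j, hj, hji⟩ := h i
    exact ⟨⟨j, hj⟩, Quotient.sound hji⟩

lemma numBlocks_bot : (⊥ : PartitionLattice n).numBlocks = n := by
  refine le_antisymm (numBlocks_le _) ?_
  simpa using ncard_le_numBlocks (x := (⊥ : PartitionLattice n)) (D := Set.univ)
    fun i _ j _ h => rel_bot.1 h

lemma ncard_add_ncard_compl_fin (D : Set (Fin n)) : D.ncard + Dᶜ.ncard = n := by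
  simpa using Set.ncard_add_ncard_compl D

lemma le_numBlocks_singleBlock (S : Set (Fin n)) : n ≤ (singleBlock S).numBlocks + S.ncard := by
  have h : (Sᶜ : Set (Fin n)).ncard ≤ (singleBlock S).numBlocks :=
    ncard_le_numBlocks fun i hi j _ hij => (rel_singleBlock.1 hij).resolve_right fun h => hi h.1
  have := ncard_add_ncard_compl_fin S
  omega

lemma numBlocks_add_ncard_le {x : PartitionLattice n} {D : Set (Fin n)}
    (h : ∀ i ∈ D, ∃ j ∉ D, x.Rel j i) : x.numBlocks + D.ncard ≤ n := by
  have h1 : x.numBlocks ≤ (Dᶜ : Set (Fin n)).ncard := numBlocks_le_ncard fun i => by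
    by_cases hi : i ∈ D
    · exact h i hi
    · exact ⟨i, hi, Rel.refl x i⟩
  have := ncard_add_ncard_compl_fin D
  omega

/-- Semimodularity of the rank: joining with `singleBlock D`, whose rank is at most |D|, destroys at
most |D| blocks. -/
lemma numBlocks_le_add_ncard {x z : PartitionLattice n} {D : Set (Fin n)}
    (h : z ≤ x ⊔ singleBlock D) : x.numBlocks ≤ z.numBlocks + D.ncard := by
  have h1 := numBlocks_add_le (bot_le : ⊥ ≤ x) (bot_le : ⊥ ≤ singleBlock D)
  have h2 := numBlocks_anti h
  have h3 := le_numBlocks_singleBlock D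
  rw [numBlocks_bot] at h1
  omega

lemma rel_apply_eq {x : PartitionLattice n} {f : Fin n → ℝ} (hf : f ∈ blockFun x) {i j : Fin n}
    (h : x.Rel i j) : f i = f j := hf h

/-- Modularity in terms of functions constant on blocks. Let h take on each block of y the value of
f at a point of S in that block, and 0 if there is none. Then h is constant on the blocks of y, and
f - h vanishes on S. -/
lemma blockFun_singleBlock_inf_le (S : Set (Fin n)) (y : PartitionLattice n) :
    blockFun (singleBlock S ⊓ y) ≤ blockFun (singleBlock S) ⊔ blockFun y := by
  classical
  intro f hf
  let h : Fin n → ℝ := fun i => if hi : ∃ s ∈ S, y.Rel i s then f hi.choose else 0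
  have hS : ∀ i ∈ S, h i = f i := by
    intro i hi
    have hi' : ∃ s ∈ S, y.Rel i s := ⟨i, hi, Rel.refl y i⟩
    simp only [h, dif_pos hi']
    exact rel_apply_eq hf (rel_inf.2
      ⟨rel_singleBlock.2 (Or.inr ⟨hi'.choose_spec.1, hi⟩), hi'.choose_spec.2.symm⟩)
  have hh : h ∈ blockFun y := by
    intro i j hij
    change h i = h j
    have hij' : y.Rel i j := hij
    by_cases hi : ∃ s ∈ S, y.Rel i s
    · have hj : ∃ s ∈ S, y.Rel j s := hi.imp fun s hs => ⟨hs.1, hij'.symm.trans hs.2⟩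
      simp only [h, dif_pos hi, dif_pos hj]
      exact rel_apply_eq hf (rel_inf.2
        ⟨rel_singleBlock.2 (Or.inr ⟨hi.choose_spec.1, hj.choose_spec.1⟩),
          hi.choose_spec.2.symm.trans (hij'.trans hj.choose_spec.2)⟩)
    · have hj : ¬ ∃ s ∈ S, y.Rel j s := fun hj => hi (hj.imp fun s hs => ⟨hs.1, hij'.trans hs.2⟩)
      simp only [h, dif_neg hi, dif_neg hj]
  have hfh : f - h ∈ blockFun (singleBlock S) := by
    intro i j hij
    change f i - h i = f j - h j
    rcases (hij : i = j ∨ i ∈ S ∧ j ∈ S) with rfl | ⟨hi, hj⟩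
    · rfl
    · rw [hS i hi, hS j hj, sub_self, sub_self]
  rw [← sub_add_cancel f h]
  exact Submodule.add_mem_sup hfh hh

/-- Partitions with at most one non-trivial block are modular elements of the partition lattice. -/
lemma numBlocks_singleBlock_sup_add_inf (S : Set (Fin n)) (y : PartitionLattice n) :
    (singleBlock S ⊔ y).numBlocks + (singleBlock S ⊓ y).numBlocks =
      (singleBlock S).numBlocks + y.numBlocks := by
  refine le_antisymm ?_ ?_
  · simp only [← finrank_blockFun]
    rw [← Submodule.finrank_sup_add_finrank_inf_eq (blockFun (singleBlock S)) (blockFun y),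
      blockFun_sup, add_comm]
    exact Nat.add_le_add_right (Submodule.finrank_mono (blockFun_singleBlock_inf_le S y)) _
  · rw [add_comm (numBlocks (_ ⊔ _))]
    exact numBlocks_add_le inf_le_left inf_le_right

/-! ### Approximate meets with partitions into blocks of size at most two -/

/-- A section of π misses |α| - |β| points. A point in a non-singleton fibre is one of these, or is
the section's value on the fibre of one of these, whence the factor 2. -/
lemma ncard_setOf_exists_ne_apply_eq_le {α β : Type*} [Fintype α] [Fintype β] (π : α → β)
    (hπ : Function.Surjective π) :
    {a | ∃ b, b ≠ a ∧ π b = π a}.ncard + 2 * Nat.card β ≤ 2 * Nat.card α := by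
  classical
  let s := Function.surjInv hπ
  have hs : ∀ b, π (s b) = b := Function.surjInv_eq hπ
  have hinj : Function.Injective s := Function.injective_surjInv hπ
  have h1 : (Set.range s).ncard = Nat.card β := by
    rw [← Nat.card_coe_set_eq, Nat.card_range_of_injective hinj]
  have h2 := Set.ncard_add_ncard_compl (Set.range s)
  have h3 : {a | ∃ b, b ≠ a ∧ π b = π a} ⊆
      (Set.range s)ᶜ ∪ (fun a => s (π a)) '' (Set.range s)ᶜ := by
    rintro a ⟨b, hba, hab⟩
    by_cases ha : a ∈ Set.range s
    · right
      obtain ⟨c, rfl⟩ := ha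
      rw [hs] at hab
      refine ⟨b, ?_, by simp only [hab]⟩
      rintro ⟨d, rfl⟩
      rw [hs] at hab
      exact hba (by rw [hab])
    · exact Or.inl ha
  have h4 := (Set.ncard_le_ncard h3).trans (Set.ncard_union_le _ _)
  have h5 := Set.ncard_image_le (f := fun a => s (π a)) (s := (Set.range s)ᶜ)
  omega

/-- If the blocks of `y` have at most two elements, then an element that is almost below `y` is
close to its meet with `y`. -/
lemma numBlocks_inf_le {y : PartitionLattice n}
    (hy : ∀ i j k, y.Rel i j → y.Rel i k → i = j ∨ i = k ∨ j = k) (w : PartitionLattice n) :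
    (w ⊓ y).numBlocks + 4 * (w ⊔ y).numBlocks ≤ w.numBlocks + 4 * y.numBlocks := by
  classical
  -- The points whose block in y grows in w + y. Passing from w to w y costs at most |D| blocks; at
  -- most 2(#y - #(w + y)) blocks of y grow, each with at most two points, which gives the constant
  -- 4.
  set D : Set (Fin n) := {i | ∃ j, (w ⊔ y).Rel i j ∧ ¬ y.Rel i j} with hD
  have h1 : w ≤ (w ⊓ y) ⊔ singleBlock D := by
    refine le_iff_rel.2 fun i j hij => ?_
    have hu : (w ⊔ y).Rel i j := hij.mono le_sup_left
    by_cases hyij : y.Rel i j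
    · exact Rel.mono le_sup_left (rel_inf.2 ⟨hij, hyij⟩)
    · exact Rel.mono le_sup_right (rel_singleBlock.2
        (Or.inr ⟨⟨j, hu, hyij⟩, i, hu.symm, fun h => hyij h.symm⟩))
  have h2 := numBlocks_le_add_ncard h1
  let sy : Setoid (Fin n) := y
  let su : Setoid (Fin n) := w ⊔ y
  let π : Quotient sy → Quotient su :=
    Quotient.map' id (fun i j (h : y.Rel i j) => (h.mono le_sup_right : (w ⊔ y).Rel i j))
  have hπ : Function.Surjective π := fun q => by
    induction q using Quotient.inductionOn with
    | h i => exact ⟨Quotient.mk sy i, rfl⟩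
  have h3 := ncard_setOf_exists_ne_apply_eq_le π hπ
  have h4 : D.ncard ≤ 2 * {a | ∃ b, b ≠ a ∧ π b = π a}.ncard := by
    rw [Set.ncard_eq_toFinset_card', Set.ncard_eq_toFinset_card']
    refine (Finset.card_le_mul_card_image_of_maps_to (f := fun i => Quotient.mk sy i)
      (t := {a | ∃ b, b ≠ a ∧ π b = π a}.toFinset) ?_ 2 ?_).trans le_rfl
    · intro i hi
      rw [Set.mem_toFinset] at hi ⊢
      obtain ⟨j, hu, hj⟩ := hi
      exact ⟨Quotient.mk sy j, fun h => hj (Rel.symm (Quotient.exact h)), Quotient.sound (Rel.symm hu)⟩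
    · intro q _
      by_contra! h
      obtain ⟨i, hi, j, hj, k, hk, hij, hik, hjk⟩ := Finset.two_lt_card.1 h
      simp only [Finset.mem_filter] at hi hj hk
      have e1 : y.Rel i j := Quotient.exact (hi.2.trans hj.2.symm)
      have e2 : y.Rel i k := Quotient.exact (hi.2.trans hk.2.symm)
      rcases hy i j k e1 e2 with h | h | h
      exacts [hij h, hik h, hjk h]
  have h5 := numBlocks_eq_card_quotient y
  have h6 := numBlocks_eq_card_quotient (w ⊔ y)
  change _ = Nat.card (Quotient sy) at h5
  change _ = Nat.card (Quotient su) at h6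
  omega

/-! ### The test partition for the converse -/

/-- The involution exchanges two disjoint halves D and E of T, each of size ⌊|T|/2⌋; a leftover
point of an odd T is fixed, whence the + 1. -/
lemma exists_involutive_pairing (T : Set (Fin n)) :
    ∃ (τ : Fin n → Fin n) (D : Set (Fin n)), Function.Involutive τ ∧ D ⊆ T ∧
      (∀ t ∈ T, τ t ∈ T) ∧ (∀ t ∈ D, τ t ∉ D) ∧ T.ncard ≤ 2 * D.ncard + 1 := by
  classical
  rcases isEmpty_or_nonempty (Fin n) with hn | hn
  · refine ⟨id, ∅, fun _ => rfl, Set.empty_subset _, fun _ h => h, fun _ h => h.elim, ?_⟩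
    rw [Set.eq_empty_of_isEmpty T]
    simp
  obtain ⟨D, hDT, hD⟩ := Set.exists_subset_card_eq (s := T) (n := T.ncard / 2) (by omega)
  have h1 := Set.ncard_sdiff_add_ncard_of_subset hDT
  obtain ⟨E, hET, hE⟩ := Set.exists_subset_card_eq (s := T \ D) (n := T.ncard / 2) (by omega)
  obtain ⟨f, hf⟩ := (Set.toFinite D).exists_bijOn_of_encard_eq (t := E) (by
    rw [← (Set.toFinite D).cast_ncard_eq, ← (Set.toFinite E).cast_ncard_eq, hD, hE])
  have hDE : ∀ i ∈ E, i ∉ D := fun i hi => (hET hi).2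
  let g := Function.invFunOn f D
  have hg1 : ∀ i ∈ E, g i ∈ D := fun i hi => Function.invFunOn_mem (hf.surjOn hi)
  have hg2 : ∀ i ∈ E, f (g i) = i := fun i hi => Function.invFunOn_eq (hf.surjOn hi)
  have hg3 : ∀ i ∈ D, g (f i) = i := fun i hi =>
    hf.injOn (hg1 _ (hf.mapsTo hi)) hi (hg2 _ (hf.mapsTo hi))
  let τ : Fin n → Fin n := fun i => if i ∈ D then f i else if i ∈ E then g i else i
  have τD : ∀ i ∈ D, τ i = f i := fun i hi => by simp [τ, hi]
  have τE : ∀ i ∈ E, τ i = g i := fun i hi => by simp [τ, hi, hDE i hi]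
  have τN : ∀ i, i ∉ D → i ∉ E → τ i = i := fun i hi hi' => by simp [τ, hi, hi']
  refine ⟨τ, D, fun i => ?_, hDT, fun i hi => ?_, fun i hi => ?_, by omega⟩
  · by_cases hi : i ∈ D
    · rw [τD i hi, τE _ (hf.mapsTo hi), hg3 i hi]
    · by_cases hi' : i ∈ E
      · rw [τE i hi', τD _ (hg1 i hi'), hg2 i hi']
      · rw [τN i hi hi', τN i hi hi']
  · by_cases hi1 : i ∈ D
    · rw [τD i hi1]
      exact (hET (hf.mapsTo hi1)).1
    · by_cases hi' : i ∈ E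
      · rw [τE i hi']
        exact hDT (hg1 i hi')
      · rwa [τN i hi1 hi']
  · rw [τD i hi]
    exact hDE _ (hf.mapsTo hi)

/-- The partition into the orbits of an involution. -/
def orbits (σ : Fin n → Fin n) (hσ : Function.Involutive σ) : PartitionLattice n :=
  (⟨fun i j => j = i ∨ j = σ i, fun _ => Or.inl rfl,
    fun {i j} h => by
      rcases h with rfl | rfl
      · exact Or.inl rfl
      · exact Or.inr (hσ i).symm,
    fun {i j k} h h' => by
      rcases h with rfl | rfl
      · exact h'
      · rcases h' with rfl | rfl
        · exact Or.inr rfl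
        · exact Or.inl (hσ i)⟩ : Setoid (Fin n))

lemma rel_orbits {σ : Fin n → Fin n} {hσ : Function.Involutive σ} {i j : Fin n} :
    (orbits σ hσ).Rel i j ↔ j = i ∨ j = σ i := Iff.rfl

/-- Two points in each non-trivial block of `x`, forming the sets `T` and `U`, and a partition `y`
that joins most of these blocks in pairs, once through `T` and once through `U`. -/
lemma exists_double_pairing (x : PartitionLattice n) :
    ∃ (S T U D : Set (Fin n)) (y : PartitionLattice n),
      x ≤ singleBlock S ∧ singleBlock S ≤ x ⊔ singleBlock T ∧
      x ⊓ singleBlock T = ⊥ ∧ x ⊓ singleBlock U = ⊥ ∧ singleBlock T ⊓ singleBlock U = ⊥ ∧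
      (∀ w ≤ y, w ≤ w ⊓ singleBlock T ⊔ w ⊓ singleBlock U) ∧
      (∀ i j k, y.Rel i j → y.Rel i k → i = j ∨ i = k ∨ j = k) ∧
      y ≤ x ⊔ y ⊓ singleBlock T ∧ T.ncard ≤ 2 * D.ncard + 1 ∧
      (y ⊓ singleBlock U).numBlocks + D.ncard ≤ n := by
  classical
  let r : Fin n → Fin n := fun i => (Quotient.mk (x : Setoid (Fin n)) i).out
  have hr : ∀ i, x.Rel (r i) i := fun i => Quotient.exact (Quotient.out_eq _)
  have hr' : ∀ {i j}, x.Rel i j → r i = r j := fun h => congrArg Quotient.out (Quotient.sound h)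
  let S : Set (Fin n) := {i | ∃ j, j ≠ i ∧ x.Rel i j}
  have hb : ∀ i, ∃ j, i ∈ S → j ≠ i ∧ x.Rel i j := fun i => by
    by_cases hi : i ∈ S
    · exact hi.imp fun j hj _ => hj
    · exact ⟨i, fun h => (hi h).elim⟩
  choose b hb using hb
  -- T holds the representative of each non-trivial block, and b selects a second point of that
  -- block.
  let T : Set (Fin n) := {i | r i = i ∧ i ∈ S}
  have hTr : ∀ t ∈ T, r t = t := fun t ht => ht.1
  have hbr : ∀ t ∈ T, r (b t) = t := fun t ht => (hr' (hb t ht.2).2).symm.trans ht.1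
  have hbT : ∀ t ∈ T, b t ∉ T := fun t ht h =>
    (hb t ht.2).1 ((hTr _ h).symm.trans (hbr t ht))
  have hxb : ∀ t ∈ T, x.Rel t (b t) := fun t ht => (hb t ht.2).2
  have hbinj : Set.InjOn b T := fun t ht t' ht' h => by rw [← hbr t ht, h, hbr t' ht']
  obtain ⟨τ, D, hτ, hDT, hτT, hτD, hcard⟩ := exists_involutive_pairing T
  let U : Set (Fin n) := b '' T
  have hU : ∀ t ∈ T, b t ∈ U := fun t ht => ⟨t, ht, rfl⟩
  -- The pairing τ on T, transported to U along b; r inverts b on U.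
  let σ : Fin n → Fin n := fun i => if i ∈ T then τ i else if i ∈ U then b (τ (r i)) else i
  have σT : ∀ t ∈ T, σ t = τ t := fun t ht => by simp [σ, ht]
  have σU : ∀ t ∈ T, σ (b t) = b (τ t) := fun t ht => by
    simp only [σ, hbT t ht, hU t ht, hbr t ht, if_true, if_false]
  have σN : ∀ i, i ∉ T → i ∉ U → σ i = i := fun i hi hi' => by simp [σ, hi, hi']
  have hσ : Function.Involutive σ := fun i => by
    by_cases hi : i ∈ T
    · rw [σT i hi, σT _ (hτT i hi), hτ]
    · by_cases hi' : i ∈ U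
      · obtain ⟨t, ht, rfl⟩ := hi'
        rw [σU t ht, σU _ (hτT t ht), hτ]
      · rw [σN i hi hi', σN i hi hi']
  have hDcard : (b '' D).ncard = D.ncard := (hbinj.mono hDT).ncard_image
  refine ⟨S, T, U, b '' D, orbits σ hσ, ?_, singleBlock_le.2 ?_, le_bot_iff_rel.2 ?_,
    le_bot_iff_rel.2 ?_, ?_, fun w hw => le_iff_rel.2 fun i j hij => ?_, ?_, le_iff_rel.2 ?_,
    by rwa [hDcard], numBlocks_add_ncard_le ?_⟩
  · refine le_iff_rel.2 fun i j hij => rel_singleBlock.2 (or_iff_not_imp_left.2 fun hne => ?_)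
    exact ⟨⟨j, Ne.symm hne, hij⟩, ⟨i, hne, hij.symm⟩⟩
  · have hrT : ∀ i ∈ S, r i ∈ T := by
      rintro i ⟨j, hji, hij⟩
      refine ⟨hr' (hr i), ?_⟩
      by_cases h : r i = i
      · rw [h]
        exact ⟨j, hji, hij⟩
      · exact ⟨i, Ne.symm h, hr i⟩
    intro i hi j hj
    have h : (x ⊔ singleBlock T).Rel (r i) (r j) :=
      Rel.mono le_sup_right (rel_singleBlock.2 (Or.inr ⟨hrT i hi, hrT j hj⟩))
    exact (Rel.mono le_sup_left (hr i).symm).trans (h.trans (Rel.mono le_sup_left (hr j)))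
  · rintro i j ⟨hx, hij⟩
    rcases rel_singleBlock.1 hij with h | ⟨hi, hj⟩
    · exact h
    · rw [← hTr i hi, ← hTr j hj]
      exact hr' hx
  · rintro i j ⟨hx, hij⟩
    rcases rel_singleBlock.1 hij with h | ⟨⟨s, hs, rfl⟩, ⟨t, ht, rfl⟩⟩
    · exact h
    · have : s = t := by
        rw [← hbr s hs, ← hbr t ht]
        exact hr' hx
      rw [this]
  · rw [singleBlock_inf]
    refine singleBlock_of_subsingleton ?_
    rintro i ⟨hi, t, ht, rfl⟩
    exact (hbT t ht hi).elim
  · rcases rel_orbits.1 (hij.mono hw) with rfl | h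
    · exact Rel.refl _ _
    · by_cases hi : i ∈ T
      · refine Rel.mono le_sup_left (rel_inf.2 ⟨hij, rel_singleBlock.2 (Or.inr ⟨hi, ?_⟩)⟩)
        rw [h, σT i hi]
        exact hτT i hi
      · by_cases hi' : i ∈ U
        · refine Rel.mono le_sup_right (rel_inf.2 ⟨hij, rel_singleBlock.2 (Or.inr ⟨hi', ?_⟩)⟩)
          obtain ⟨t, ht, rfl⟩ := hi'
          rw [h, σU t ht]
          exact hU _ (hτT t ht)
        · rw [h, σN i hi hi']
          exact Rel.refl _ _
  · intro i j k hij hik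
    rcases rel_orbits.1 hij with rfl | rfl
    · exact Or.inl rfl
    · rcases rel_orbits.1 hik with rfl | rfl
      · exact Or.inr (Or.inl rfl)
      · exact Or.inr (Or.inr rfl)
  · have key : ∀ t ∈ T, (x ⊔ orbits σ hσ ⊓ singleBlock T).Rel t (τ t) := fun t ht =>
      Rel.mono le_sup_right (rel_inf.2 ⟨rel_orbits.2 (Or.inr (σT t ht).symm),
        rel_singleBlock.2 (Or.inr ⟨ht, hτT t ht⟩)⟩)
    intro i j hij
    rcases rel_orbits.1 hij with rfl | rfl
    · exact Rel.refl _ _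
    · by_cases hi : i ∈ T
      · rw [σT i hi]
        exact key i hi
      · by_cases hi' : i ∈ U
        · obtain ⟨t, ht, rfl⟩ := hi'
          rw [σU t ht]
          exact (Rel.mono le_sup_left (hxb t ht).symm).trans
            ((key t ht).trans (Rel.mono le_sup_left (hxb _ (hτT t ht))))
        · rw [σN i hi hi']
          exact Rel.refl _ _
  -- Each point b t with t in D is joined inside U to b (τ t), which is not in b(D); so the points
  -- of b(D) can be dropped when counting blocks.
  · rintro i ⟨t, ht, rfl⟩
    have htT := hDT ht
    refine ⟨b (τ t), ?_, rel_inf.2 ⟨Rel.symm (rel_orbits.2 (Or.inr (σU t htT).symm)),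
      rel_singleBlock.2 (Or.inr ⟨hU _ (hτT t htT), hU t htT⟩)⟩⟩
    rintro ⟨s, hs, hst⟩
    exact hτD t ht (hbinj (hDT hs) (hτT t htT) hst ▸ hs)

/-! ### Maximal singular sublattices -/

lemma singleBlock_ne_bot {S : Set (Fin n)} (h : S.Nontrivial) : singleBlock S ≠ ⊥ := by
  obtain ⟨i, hi, j, hj, hij⟩ := h
  exact fun h => hij (le_bot_iff_rel.1 h i j (rel_singleBlock.2 (Or.inr ⟨hi, hj⟩)))

/-- Two non-trivial blocks whose join has a single non-trivial block meet. -/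
lemma inter_nonempty_of_isSingular_sup {S T : Set (Fin n)} (hS : S.Nontrivial) (hT : T.Nontrivial)
    (h : (singleBlock S ⊔ singleBlock T).IsSingular) : (S ∩ T).Nonempty := by
  obtain ⟨V, hV⟩ := isSingular_iff.1 h
  by_contra hne
  have hd : ∀ i ∈ S, i ∉ T := fun i hi hi' => hne ⟨i, hi, hi'⟩
  -- If S and T were disjoint, the partition z with both as separate blocks would bound the join,
  -- whereas the single block V of the join contains S ∪ T.
  let z : PartitionLattice n :=
    (⟨fun i j => i = j ∨ (i ∈ S ∧ j ∈ S) ∨ (i ∈ T ∧ j ∈ T), fun _ => Or.inl rfl,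
      fun {i j} h => by tauto, fun {i j k} h h' => by
        rcases h with rfl | h
        · exact h'
        · rcases h' with rfl | h'
          · exact Or.inr h
          · have := hd j
            tauto⟩ : Setoid (Fin n))
  have hz : singleBlock V ≤ z := by
    rw [← hV]
    exact sup_le (le_iff_rel.2 fun i j hij => hij.imp_right Or.inl)
      (le_iff_rel.2 fun i j hij => hij.imp_right Or.inr)
  have hV' : ∀ {R : Set (Fin n)}, R.Nontrivial → singleBlock R ≤ singleBlock V → ∀ i ∈ R, i ∈ V := by
    intro R hR hRV i hi
    obtain ⟨j, hj, hji⟩ := hR.exists_ne i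
    exact ((rel_singleBlock.1 (singleBlock_le.1 hRV i hi j hj)).resolve_left hji.symm).1
  obtain ⟨s, hs⟩ := hS.nonempty
  obtain ⟨t, ht⟩ := hT.nonempty
  have hst : z.Rel s t := singleBlock_le.1 hz s (hV' hS (hV ▸ le_sup_left) s hs) t
    (hV' hT (hV ▸ le_sup_right) t ht)
  rcases (hst : s = t ∨ (s ∈ S ∧ t ∈ S) ∨ (s ∈ T ∧ t ∈ T)) with rfl | h | h
  · exact hd s hs ht
  · exact hd t h.2 ht
  · exact hd s hs h.1

/-- The sublattice of partitions with at most one non-trivial block, which contains `p`. -/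
def pointed (p : Fin n) : Sublattice (PartitionLattice n) where
  carrier := {x | ∃ S : Set (Fin n), p ∈ S ∧ x = singleBlock S}
  supClosed' := by
    rintro _ ⟨S, hS, rfl⟩ _ ⟨T, hT, rfl⟩
    exact ⟨S ∪ T, Or.inl hS, singleBlock_sup ⟨p, hS, hT⟩⟩
  infClosed' := by
    rintro _ ⟨S, hS, rfl⟩ _ ⟨T, hT, rfl⟩
    exact ⟨S ∩ T, ⟨hS, hT⟩, singleBlock_inf S T⟩

lemma isSingularSublattice_pointed (p : Fin n) : IsSingularSublattice (pointed p) := by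
  rintro _ ⟨S, -, rfl⟩
  exact isSingular_singleBlock S

lemma isDistributiveOn_pointed (p : Fin n) :
    IsDistributiveOn (pointed p : Set (PartitionLattice n)) := by
  rintro _ ⟨S, hS, rfl⟩ _ ⟨T, hT, rfl⟩ _ ⟨U, hU, rfl⟩
  have h1 : (T ∩ U).Nonempty := ⟨p, hT, hU⟩
  have h2 : ((S ∩ T) ∩ (S ∩ U)).Nonempty := ⟨p, ⟨hS, hT⟩, hS, hU⟩
  rw [singleBlock_sup h1, singleBlock_inf, singleBlock_inf, singleBlock_inf,
    singleBlock_sup h2, Set.inter_union_distrib_left]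

/-- The blocks of a singular sublattice. -/
def blockSets (A : Sublattice (PartitionLattice n)) : Set (Set (Fin n)) :=
  {S | S.Nontrivial ∧ singleBlock S ∈ A}

lemma blockSets_inter_nonempty {A : Sublattice (PartitionLattice n)} (hA : IsSingularSublattice A)
    {S T : Set (Fin n)} (hS : S ∈ blockSets A) (hT : T ∈ blockSets A) : (S ∩ T).Nonempty :=
  inter_nonempty_of_isSingular_sup hS.1 hT.1 (hA _ (A.sup_mem hS.2 hT.2))

lemma union_mem_blockSets {A : Sublattice (PartitionLattice n)} (hA : IsSingularSublattice A)
    {S T : Set (Fin n)} (hS : S ∈ blockSets A) (hT : T ∈ blockSets A) : S ∪ T ∈ blockSets A :=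
  ⟨hS.1.mono Set.subset_union_left,
    singleBlock_sup (blockSets_inter_nonempty hA hS hT) ▸ A.sup_mem hS.2 hT.2⟩

lemma inter_mem_blockSets {A : Sublattice (PartitionLattice n)} {S T : Set (Fin n)}
    (hS : S ∈ blockSets A) (hT : T ∈ blockSets A) (h : (S ∩ T).Nontrivial) : S ∩ T ∈ blockSets A :=
  ⟨h, singleBlock_inf S T ▸ A.inf_mem hS.2 hT.2⟩

/-- The blocks of a singular sublattice have a common point, or they contain a triangle. -/
lemma exists_common_point_or_triangle (hn : 1 ≤ n) {A : Sublattice (PartitionLattice n)}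
    (hA : IsSingularSublattice A) :
    (∃ p, ∀ S ∈ blockSets A, p ∈ S) ∨ ∃ p q r : Fin n, p ≠ q ∧ p ≠ r ∧ q ≠ r ∧
      {p, q} ∈ blockSets A ∧ {p, r} ∈ blockSets A ∧ {q, r} ∈ blockSets A := by
  rcases (blockSets A).eq_empty_or_nonempty with h0 | h0
  · left
    refine ⟨⟨0, hn⟩, fun S hS => ?_⟩
    rw [h0] at hS
    exact hS.elim
  rw [or_iff_not_imp_left]
  intro hnp
  have hnp' : ∀ p, ∃ S ∈ blockSets A, p ∉ S := by simpa using hnp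
  obtain ⟨M, hM, hmin⟩ := (Set.toFinite (blockSets A)).exists_minimal h0
  -- Otherwise every M ∩ S is again a block, so minimality puts M inside every block, and any point
  -- of M is common.
  have hsub : ∃ S ∈ blockSets A, (M ∩ S).Subsingleton := by
    by_contra! h
    obtain ⟨p, hp⟩ := hM.1.nonempty
    obtain ⟨S, hS, hpS⟩ := hnp' p
    have h1 := inter_mem_blockSets hM hS (Set.not_subsingleton_iff.1 (by simpa using h S hS))
    exact hpS (hmin h1 Set.inter_subset_left hp).2
  obtain ⟨S, hS, hMS⟩ := hsub
  obtain ⟨p, hp⟩ := blockSets_inter_nonempty hA hM hS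
  obtain ⟨U, hU, hpU⟩ := hnp' p
  -- M, S and U have no common point. So no two of them share two points: their intersection would
  -- be a block disjoint from the third.
  have hdis : ∀ i, i ∈ M → i ∈ S → i ∈ U → False := fun i h1 h2 h3 =>
    hpU (hMS hp ⟨h1, h2⟩ ▸ h3)
  have hMU : (M ∩ U).Subsingleton := by
    by_contra h
    obtain ⟨i, hi⟩ := blockSets_inter_nonempty hA
      (inter_mem_blockSets hM hU (Set.not_subsingleton_iff.1 h)) hS
    exact hdis i hi.1.1 hi.2 hi.1.2
  have hSU : (S ∩ U).Subsingleton := by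
    by_contra h
    obtain ⟨i, hi⟩ := blockSets_inter_nonempty hA
      (inter_mem_blockSets hS hU (Set.not_subsingleton_iff.1 h)) hM
    exact hdis i hi.2 hi.1.1 hi.1.2
  obtain ⟨q, hq⟩ := blockSets_inter_nonempty hA hM hU
  obtain ⟨r, hr⟩ := blockSets_inter_nonempty hA hS hU
  have hpq : p ≠ q := fun h => hpU (h ▸ hq.2)
  have hpr : p ≠ r := fun h => hpU (h ▸ hr.2)
  have hqr : q ≠ r := fun h => hdis q hq.1 (h ▸ hr.1) hq.2
  -- The edges of the triangle are the sets (X ∪ Y) ∩ Z.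
  have key : ∀ {X Y Z : Set (Fin n)} {a b : Fin n}, X ∈ blockSets A → Y ∈ blockSets A →
      Z ∈ blockSets A → (X ∩ Z).Subsingleton → (Y ∩ Z).Subsingleton → a ∈ X ∩ Z → b ∈ Y ∩ Z →
      a ≠ b → {a, b} ∈ blockSets A := by
    intro X Y Z a b hX hY hZ hXZ hYZ ha hb hab
    have h : (X ∪ Y) ∩ Z = {a, b} := by
      rw [Set.union_inter_distrib_right, hXZ.eq_singleton_of_mem ha, hYZ.eq_singleton_of_mem hb]
      rfl
    rw [← h]
    refine inter_mem_blockSets (union_mem_blockSets hA hX hY) hZ ?_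
    rw [h]
    exact Set.nontrivial_pair hab
  refine ⟨p, q, r, hpq, hpr, hqr, ?_, ?_, key hM hS hU hMU hSU hq hr hqr⟩
  · exact key hS hU hM (Set.inter_comm M S ▸ hMS) (Set.inter_comm M U ▸ hMU) hp.symm hq.symm hpq
  · exact key hM hU hS hMS (Set.inter_comm S U ▸ hSU) hp hr.symm hpr

/-- If the blocks of a singular sublattice have a common point, then it is contained in the
sublattice of this point. -/
lemma le_pointed {A : Sublattice (PartitionLattice n)} (hA : IsSingularSublattice A) {p : Fin n}
    (h : ∀ S ∈ blockSets A, p ∈ S) : A ≤ pointed p := by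
  intro x hx
  obtain ⟨S, rfl⟩ := isSingular_iff.1 (hA x hx)
  rcases S.subsingleton_or_nontrivial with hS | hS
  · exact ⟨{p}, rfl, by
      rw [singleBlock_of_subsingleton hS, singleBlock_of_subsingleton Set.subsingleton_singleton]⟩
  · exact ⟨S, h S ⟨hS, hx⟩, rfl⟩

/-- The sets that contain all points of `K`, or miss a single point `t` of `K` and are contained
in `X t`. -/
def IsGood (K : Set (Fin n)) (X : Fin n → Set (Fin n)) (S : Set (Fin n)) : Prop :=
  ∀ t ∈ K, t ∉ S → K \ {t} ⊆ S ∧ S ⊆ X t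

/-- The partitions with at most one non-trivial block, which is good for a set `K` with at least
three elements. -/
def triangular (K : Set (Fin n)) (X : Fin n → Set (Fin n))
    (hKne : K.Nonempty) (hK : ∀ s t, ∃ u ∈ K, u ≠ s ∧ u ≠ t)
    (hX : ∀ s ∈ K, ∀ t ∈ K, s ≠ t → (X s ∩ X t).Subsingleton) :
    Sublattice (PartitionLattice n) where
  carrier := {x | x = ⊥ ∨ ∃ S, IsGood K X S ∧ x = singleBlock S}
  supClosed' := by
    rintro x hx y hy
    rcases hx with rfl | ⟨S, hS, rfl⟩
    · simpa using hy
    rcases hy with rfl | ⟨T, hT, rfl⟩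
    · simpa using Or.inr ⟨S, hS, rfl⟩
    -- A good set misses at most one point of K, and K is not covered by two points.
    have hne : (S ∩ T).Nonempty := by
      have h : ∀ {R : Set (Fin n)}, IsGood K X R → ∃ s, ∀ u ∈ K, u ≠ s → u ∈ R := by
        intro R hR
        by_cases h : K ⊆ R
        · obtain ⟨s, -⟩ := hKne
          exact ⟨s, fun u hu _ => h hu⟩
        · obtain ⟨t, ht, htR⟩ := Set.not_subset.1 h
          exact ⟨t, fun u hu hut => (hR t ht htR).1 ⟨hu, hut⟩⟩
      obtain ⟨s, hs⟩ := h hS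
      obtain ⟨t, ht⟩ := h hT
      obtain ⟨u, hu, hus, hut⟩ := hK s t
      exact ⟨u, hs u hu hus, ht u hu hut⟩
    refine Or.inr ⟨S ∪ T, fun t ht htu => ?_, singleBlock_sup hne⟩
    have h1 := hS t ht fun h => htu (Or.inl h)
    have h2 := hT t ht fun h => htu (Or.inr h)
    exact ⟨h1.1.trans Set.subset_union_left, Set.union_subset h1.2 h2.2⟩
  infClosed' := by
    rintro x hx y hy
    rcases hx with rfl | ⟨S, hS, rfl⟩
    · simp
    rcases hy with rfl | ⟨T, hT, rfl⟩
    · simp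
    change _ ∨ _
    rw [singleBlock_inf]
    rcases (S ∩ T).subsingleton_or_nontrivial with h | h
    · exact Or.inl (singleBlock_of_subsingleton h)
    refine Or.inr ⟨S ∩ T, ?_, rfl⟩
    -- If S and T missed different points t and u of K, then S ∩ T would lie in X t ∩ X u, which has
    -- at most one point.
    have key : ∀ {S T : Set (Fin n)}, IsGood K X S → IsGood K X T → (S ∩ T).Nontrivial →
        ∀ t ∈ K, t ∉ S → K \ {t} ⊆ S ∩ T ∧ S ∩ T ⊆ X t := by
      intro S T hS hT h t ht htS
      refine ⟨fun u hu => ⟨(hS t ht htS).1 hu, ?_⟩, Set.inter_subset_left.trans (hS t ht htS).2⟩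
      by_contra huT
      exact Set.not_subsingleton_iff.2 h ((hX t ht u hu.1 (Ne.symm hu.2)).anti
        (Set.inter_subset_inter (hS t ht htS).2 (hT u hu.1 huT).2))
    intro t ht htST
    by_cases htS : t ∈ S
    · rw [Set.inter_comm]
      exact key hT hS (Set.inter_comm S T ▸ h) t ht fun htT => htST ⟨htS, htT⟩
    · exact key hS hT h t ht htS

/-- A maximal singular sublattice whose blocks contain a triangle is a triangular sublattice. -/
lemma singleBlock_mem_of_triangle {A : Sublattice (PartitionLattice n)}
    (hA : Maximal IsSingularSublattice A) {p q r : Fin n} (hpq : p ≠ q) (hpr : p ≠ r) (hqr : q ≠ r)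
    (h1 : {p, q} ∈ blockSets A) (h2 : {p, r} ∈ blockSets A) (h3 : {q, r} ∈ blockSets A)
    {S : Set (Fin n)} (hS : {p, q, r} ⊆ S) : singleBlock S ∈ A := by
  set K : Set (Fin n) := {p, q, r} with hKdef
  -- A block meets each edge of the triangle, hence misses at most one vertex.
  have hmeet : ∀ S ∈ blockSets A, ∀ t ∈ K, t ∉ S → K \ {t} ⊆ S := by
    intro S hS
    have e : ∀ {a b : Fin n}, {a, b} ∈ blockSets A → a ∈ S ∨ b ∈ S := by
      intro a b hab
      obtain ⟨i, hi, rfl | rfl⟩ := blockSets_inter_nonempty hA.prop hS hab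
      exacts [Or.inl hi, Or.inr hi]
    have e1 := e h1
    have e2 := e h2
    have e3 := e h3
    rintro t (rfl | rfl | rfl) ht u ⟨rfl | rfl | rfl, hu⟩ <;>
      first
      | exact (hu rfl).elim
      | tauto
  -- X t is the largest block that misses t; it exists because blocks are closed under union.
  have hmax : ∀ t, ∃ X, t ∈ K → t ∉ X ∧ X ∈ blockSets A ∧
      ∀ S ∈ blockSets A, t ∉ S → S ⊆ X := by
    intro t
    by_cases ht : t ∈ K
    · have hne : {S | S ∈ blockSets A ∧ t ∉ S}.Nonempty := by
        rcases ht with rfl | rfl | rfl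
        · exact ⟨_, h3, by simp [hpq, hpr]⟩
        · exact ⟨_, h2, by simp [hpq.symm, hqr]⟩
        · exact ⟨_, h1, by simp [hpr.symm, hqr.symm]⟩
      obtain ⟨X, hX, hXmax⟩ := (Set.toFinite {S | S ∈ blockSets A ∧ t ∉ S}).exists_maximal hne
      refine ⟨X, fun _ => ⟨hX.2, hX.1, fun S hS htS => ?_⟩⟩
      exact Set.subset_union_left.trans (hXmax (y := S ∪ X)
        ⟨union_mem_blockSets hA.prop hS hX.1, by simp [htS, hX.2]⟩ Set.subset_union_right)
    · exact ⟨∅, fun h => (ht h).elim⟩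
  choose X hX using hmax
  have hXX : ∀ s ∈ K, ∀ t ∈ K, s ≠ t → (X s ∩ X t).Subsingleton := by
    intro s hs t ht hst
    by_contra h
    have h' := inter_mem_blockSets (hX s hs).2.1 (hX t ht).2.1 (Set.not_subsingleton_iff.1 h)
    exact (hX t ht).1 (hmeet _ h' s hs (fun h => (hX s hs).1 h.1) ⟨ht, hst.symm⟩).2
  have hK : ∀ s t, ∃ u ∈ K, u ≠ s ∧ u ≠ t := by
    intro s t
    by_contra! h
    have e1 := h p (by simp [K])
    have e2 := h q (by simp [K])
    have e3 := h r (by simp [K])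
    by_cases hp : p = s
    · subst hp
      exact hqr ((e2 hpq.symm).trans (e3 hpr.symm).symm)
    · have hp' := e1 hp
      subst hp'
      by_cases hq : q = s
      · subst hq
        exact hpr (e3 hqr.symm).symm
      · exact hpq (e2 hq).symm
  -- By maximality this inclusion is an equality, and any set containing K is vacuously good.
  have hle : A ≤ triangular K X ⟨p, by simp [K]⟩ hK hXX := by
    intro x hx
    obtain ⟨S, rfl⟩ := isSingular_iff.1 (hA.prop x hx)
    rcases S.subsingleton_or_nontrivial with hS | hS
    · exact Or.inl (singleBlock_of_subsingleton hS)
    · exact Or.inr ⟨S, fun t ht htS => ⟨hmeet S ⟨hS, hx⟩ t ht htS, (hX t ht).2.2 S ⟨hS, hx⟩ htS⟩,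
        rfl⟩
  refine hA.le_of_ge (y := triangular K X ⟨p, by simp [K]⟩ hK hXX) ?_ hle
    (Or.inr ⟨S, fun t ht htS => (htS (hS ht)).elim, rfl⟩)
  rintro x (rfl | ⟨S, -, rfl⟩)
  · rw [← singleBlock_of_subsingleton (Set.subsingleton_empty (α := Fin n))]
    exact isSingular_singleBlock _
  · exact isSingular_singleBlock S

/-- The edges of a triangle have pairwise meet 0, while the join of two of them lies above the
third. -/
lemma not_isDistributiveOn_of_triangle {A : Sublattice (PartitionLattice n)} {p q r : Fin n}
    (hpq : p ≠ q) (hpr : p ≠ r) (hqr : q ≠ r) (h1 : {p, q} ∈ blockSets A)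
    (h2 : {p, r} ∈ blockSets A) (h3 : {q, r} ∈ blockSets A) :
    ¬ IsDistributiveOn (A : Set (PartitionLattice n)) := by
  intro h
  have h' := h _ h1.2 _ h2.2 _ h3.2
  have e1 : ({p, q} ∩ {p, r} : Set (Fin n)).Subsingleton := by
    rintro i ⟨rfl | rfl, hi⟩ j ⟨rfl | rfl, hj⟩ <;> simp_all
  have e2 : ({p, q} ∩ {q, r} : Set (Fin n)).Subsingleton := by
    rintro i ⟨rfl | rfl, hi⟩ j ⟨rfl | rfl, hj⟩ <;> simp_all
  rw [singleBlock_sup ⟨r, by simp⟩, singleBlock_inf, singleBlock_inf, singleBlock_inf,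
    singleBlock_of_subsingleton e1, singleBlock_of_subsingleton e2, sup_idem] at h'
  refine singleBlock_ne_bot ?_ h'
  exact ⟨p, by simp, q, by simp, hpq⟩

/-- Maximal singular sublattices and maximal distributive singular sublattices contain all
partitions with one non-trivial block that contains a certain set of at most three points. -/
lemma exists_forall_singleBlock_mem {A : Sublattice (PartitionLattice n)}
    (hA : Maximal IsSingularSublattice A ∨ Maximal IsSingularDistributiveSublattice A) :
    ∃ K : Set (Fin n), K.ncard ≤ 3 ∧ ∀ S, K ⊆ S → singleBlock S ∈ A := by
  have hs : IsSingularSublattice A := hA.elim (fun h => h.prop) fun h => h.prop.1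
  -- For n = 0 there is no point to choose, but the lattice has a single element.
  rcases Nat.eq_zero_or_pos n with rfl | hn
  · refine ⟨∅, by simp, fun S _ => ?_⟩
    have ht : IsSingularSublattice (⊤ : Sublattice (PartitionLattice 0)) := fun x _ => by
      rw [eq_of_lt_two (by omega) x (singleBlock ∅)]
      exact isSingular_singleBlock ∅
    have h : (⊤ : Sublattice (PartitionLattice 0)) ≤ A := by
      rcases hA with hA | hA
      · exact hA.le_of_ge ht le_top
      · exact hA.le_of_ge ⟨ht, fun x _ y _ z _ => eq_of_lt_two (by omega) _ _⟩ le_top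
    exact h trivial
  rcases exists_common_point_or_triangle hn hs with ⟨p, hp⟩ | ⟨p, q, r, hpq, hpr, hqr, h1, h2, h3⟩
  · refine ⟨{p}, by simp, fun S hS => ?_⟩
    have h : pointed p ≤ A := by
      rcases hA with hA | hA
      · exact hA.le_of_ge (isSingularSublattice_pointed p) (le_pointed hs hp)
      · exact hA.le_of_ge ⟨isSingularSublattice_pointed p, isDistributiveOn_pointed p⟩
          (le_pointed hs hp)
    exact h ⟨S, hS rfl, rfl⟩
  · rcases hA with hA | hA
    · refine ⟨{p, q, r}, ?_, fun S hS =>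
        singleBlock_mem_of_triangle hA hpq hpr hqr h1 h2 h3 hS⟩
      refine (Set.ncard_insert_le _ _).trans ?_
      have := Set.ncard_insert_le q {r}
      rw [Set.ncard_singleton] at this
      omega
    · exact (not_isDistributiveOn_of_triangle hpq hpr hqr h1 h2 h3 hA.prop.2).elim

lemma dist_of_le {x y : PartitionLattice n} (h : x ≤ y) :
    dist x y = ((x.numBlocks : ℝ) - y.numBlocks) / ((n : ℝ) - 1) := by
  rw [dist_def, sup_eq_right.2 h]
  ring

/-- The extra 1 pays for a point of S adjoined to K, so that the two blocks merge even if S and K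
are disjoint. -/
lemma numBlocks_singleBlock_le_union (S K : Set (Fin n)) :
    (singleBlock S).numBlocks ≤ (singleBlock (S ∪ K)).numBlocks + (K.ncard + 1) := by
  rcases S.eq_empty_or_nonempty with rfl | ⟨s, hs⟩
  · rw [Set.empty_union]
    have h : singleBlock K ≤ singleBlock ∅ ⊔ singleBlock K := le_sup_right
    exact (numBlocks_le_add_ncard h).trans (by omega)
  · have h : (S ∩ insert s K).Nonempty := ⟨s, hs, Or.inl rfl⟩
    refine (numBlocks_le_add_ncard (D := insert s K) ?_).trans
      (Nat.add_le_add_left (Set.ncard_insert_le _ _) _)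
    rw [singleBlock_sup h]
    exact singleBlock_mono (Set.union_subset_union_right S (Set.subset_insert s K))

end PartitionLattice

/-! ### Rank and meets in the ultraproduct -/

namespace Ultraproduct

open PartitionLattice

variable {𝒰 : Ultrafilter ℕ}

lemma mk_le_mk {x y : ∀ n, PartitionLattice n} (h : ∀ n, x n ≤ y n) : mk 𝒰 x ≤ mk 𝒰 y := by
  rw [← sup_eq_right, mk_sup]
  exact congrArg (mk 𝒰) (funext fun n => sup_eq_right.2 (h n))

lemma mk_bot : mk 𝒰 (fun _ => ⊥) = ⊥ := rfl

lemma mk_top : mk 𝒰 (fun _ => ⊤) = ⊤ := rfl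

lemma dist_sup_sup_le (a b c : Ultraproduct 𝒰) : dist (a ⊔ c) (b ⊔ c) ≤ dist a b := by
  obtain ⟨x, rfl⟩ := mk_surjective a
  obtain ⟨y, rfl⟩ := mk_surjective b
  obtain ⟨z, rfl⟩ := mk_surjective c
  exact le_of_tendsto_of_tendsto' (tendsto_dist _ _) (tendsto_dist x y)
    fun n => PartitionLattice.dist_sup_sup_le (x n) (y n) (z n)

lemma eq_of_le_of_dist_le {a b : Ultraproduct 𝒰} (h : a ≤ b) (h' : dist b ⊥ ≤ dist a ⊥) :
    a = b := by
  have h1 := dist_sup_eq a b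
  rw [sup_eq_right.2 h] at h1
  exact dist_eq_zero.1 (le_antisymm (by linarith) dist_nonneg)

lemma dist_sup_add_dist_le {w a b : Ultraproduct 𝒰} (ha : w ≤ a) (hb : w ≤ b) :
    dist (a ⊔ b) ⊥ + dist w ⊥ ≤ dist a ⊥ + dist b ⊥ := by
  have h1 := dist_sup_sup_le w a b
  have h2 := dist_sup_eq w a
  have h3 := dist_sup_eq b a
  rw [sup_eq_right.2 ha] at h2
  rw [sup_eq_right.2 hb, sup_comm a b] at h1
  rw [sup_comm a b]
  linarith

/-- Semimodularity bounds |a b| by |a| + |b| - |a + b|; a common lower bound reaching this rank is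
the meet, since comparable elements of equal rank coincide. -/
lemma inf_eq_of_dist {c a b : Ultraproduct 𝒰} (ha : c ≤ a) (hb : c ≤ b)
    (h : dist a ⊥ + dist b ⊥ ≤ dist (a ⊔ b) ⊥ + dist c ⊥) : a ⊓ b = c := by
  refine (eq_of_le_of_dist_le (le_inf ha hb) ?_).symm
  have := dist_sup_add_dist_le (inf_le_left : a ⊓ b ≤ a) inf_le_right
  linarith

lemma dist_mk_singleBlock (S : ∀ n, Set (Fin n)) (y : ∀ n, PartitionLattice n) :
    dist (mk 𝒰 (fun n => singleBlock (S n)) ⊔ mk 𝒰 y) ⊥ +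
      dist (mk 𝒰 (fun n => singleBlock (S n) ⊓ y n)) ⊥ =
      dist (mk 𝒰 (fun n => singleBlock (S n))) ⊥ + dist (mk 𝒰 y) ⊥ := by
  refine tendsto_nhds_unique ((tendsto_dist (𝒰 := 𝒰) _ (fun _ => ⊥)).add
    (tendsto_dist _ (fun _ => ⊥))) (((tendsto_dist (𝒰 := 𝒰) (fun n => singleBlock (S n))
      (fun _ => ⊥)).add (tendsto_dist y (fun _ => ⊥))).congr fun n => ?_)
  have h : ((singleBlock (S n) ⊔ y n).numBlocks : ℝ) + (singleBlock (S n) ⊓ y n).numBlocks =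
      (singleBlock (S n)).numBlocks + (y n).numBlocks := by
    exact_mod_cast numBlocks_singleBlock_sup_add_inf (S n) (y n)
  simp only [dist_def, sup_bot_eq, ← add_div]
  congr 1
  linarith

lemma mk_singleBlock_inf (S : ∀ n, Set (Fin n)) (y : ∀ n, PartitionLattice n) :
    mk 𝒰 (fun n => singleBlock (S n)) ⊓ mk 𝒰 y = mk 𝒰 (fun n => singleBlock (S n) ⊓ y n) :=
  inf_eq_of_dist (mk_le_mk fun _ => inf_le_left) (mk_le_mk fun _ => inf_le_right)
    (dist_mk_singleBlock S y).ge

lemma isMetricallyModular_mk_singleBlock (S : ∀ n, Set (Fin n)) :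
    IsMetricallyModular (mk 𝒰 (fun n => singleBlock (S n))) := by
  intro b
  obtain ⟨y, rfl⟩ := mk_surjective b
  rw [mk_singleBlock_inf]
  exact dist_mk_singleBlock S y

/-! ### Changes of o(n) blocks -/

lemma tendsto_div_sub_one (h𝒰 : ∀ m : ℕ, 𝒰 ≠ pure m) (C : ℝ) :
    Tendsto (fun n : ℕ => C / ((n : ℝ) - 1)) 𝒰 (𝓝 0) := by
  have h : (𝒰 : Filter ℕ) ≤ atTop := by
    rw [← Nat.cofinite_eq_atTop]
    exact 𝒰.le_cofinite_or_eq_pure.resolve_right fun ⟨m, hm⟩ => h𝒰 m hm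
  refine Tendsto.mono_left ?_ h
  exact tendsto_const_nhds.div_atTop
    (tendsto_atTop_add_const_right _ (-1) tendsto_natCast_atTop_atTop)

/-- Excludes n = 0, where the denominator n - 1 is negative; n = 1 is harmless because division by 0
gives 0. -/
lemma eventually_one_le (h𝒰 : ∀ m : ℕ, 𝒰 ≠ pure m) : ∀ᶠ n in (𝒰 : Filter ℕ), 1 ≤ n := by
  have h : (𝒰 : Filter ℕ) ≤ atTop := by
    rw [← Nat.cofinite_eq_atTop]
    exact 𝒰.le_cofinite_or_eq_pure.resolve_right fun ⟨m, hm⟩ => h𝒰 m hm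
  exact h (eventually_ge_atTop 1)

/-- Comparable sequences whose numbers of blocks differ by `o(n)` represent the same element. -/
lemma mk_eq_mk_of_le (h𝒰 : ∀ m : ℕ, 𝒰 ≠ pure m) {x y : ∀ n, PartitionLattice n} {c : ℕ → ℝ}
    (hxy : ∀ n, x n ≤ y n) (h : ∀ n, ((x n).numBlocks : ℝ) ≤ (y n).numBlocks + c n)
    (hc : Tendsto (fun n => c n / ((n : ℝ) - 1)) 𝒰 (𝓝 0)) : mk 𝒰 x = mk 𝒰 y := by
  refine mk_eq_mk (squeeze_zero' (Eventually.of_forall fun _ => dist_nonneg) ?_ hc)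
  filter_upwards [eventually_one_le h𝒰] with n hn
  rw [dist_of_le (hxy n)]
  have : (1 : ℝ) ≤ n := by exact_mod_cast hn
  exact div_le_div_of_nonneg_right (by linarith [h n]) (by linarith)

lemma mk_singleBlock_union (h𝒰 : ∀ m : ℕ, 𝒰 ≠ pure m) (S K : ∀ n, Set (Fin n))
    (hK : ∀ n, (K n).ncard ≤ 3) :
    mk 𝒰 (fun n => singleBlock (S n)) = mk 𝒰 (fun n => singleBlock (S n ∪ K n)) := by
  refine mk_eq_mk_of_le h𝒰 (c := fun _ => 4)
    (fun n => singleBlock_mono Set.subset_union_left) (fun n => ?_) (tendsto_div_sub_one h𝒰 4)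
  have h := numBlocks_singleBlock_le_union (S n) (K n)
  have h' : (singleBlock (S n)).numBlocks ≤ (singleBlock (S n ∪ K n)).numBlocks + 4 :=
    h.trans (by have := hK n; omega)
  exact_mod_cast h'

/-! ### The Boolean lattice of one-block elements -/

lemma ofSets_eq_range (h𝒰 : ∀ m : ℕ, 𝒰 ≠ pure m) (A : ∀ n : ℕ, Sublattice (PartitionLattice n))
    (hA : ∀ n, ∀ x ∈ A n, x.IsSingular)
    (hK : ∀ n, ∃ K : Set (Fin n), K.ncard ≤ 3 ∧ ∀ S, K ⊆ S → singleBlock S ∈ A n) :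
    ofSets 𝒰 (fun n => (A n : Set (PartitionLattice n))) =
      Set.range fun S : ∀ n, Set (Fin n) => mk 𝒰 (fun n => singleBlock (S n)) := by
  ext p
  constructor
  · rintro ⟨x, hx, rfl⟩
    choose S hS using fun n => isSingular_iff.1 (hA n (x n) (hx n))
    exact ⟨S, congrArg (mk 𝒰) (funext fun n => (hS n).symm)⟩
  · rintro ⟨S, rfl⟩
    choose K hK hKA using hK
    exact ⟨_, fun n => hKA n (S n ∪ K n) Set.subset_union_right,
      (mk_singleBlock_union h𝒰 S K hK).symm⟩

/-- The join of elements represented by partitions with one non-trivial block. -/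
lemma mk_singleBlock_sup (h𝒰 : ∀ m : ℕ, 𝒰 ≠ pure m) (S T : ∀ n, Set (Fin n)) :
    mk 𝒰 (fun n => singleBlock (S n)) ⊔ mk 𝒰 (fun n => singleBlock (T n)) =
      mk 𝒰 (fun n => singleBlock (S n ∪ T n)) := by
  -- Adjoining the point 0 to all sets makes them meet, so that their joins have one block.
  let K : ∀ n, Set (Fin n) := fun n => {i | (i : ℕ) = 0}
  have hK : ∀ n, (K n).ncard ≤ 3 := fun n =>
    (Set.ncard_le_one_iff_subsingleton.2 fun i hi j hj => Fin.ext (hi.trans hj.symm)).trans (by omega)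
  rw [mk_singleBlock_union h𝒰 S K hK, mk_singleBlock_union h𝒰 T K hK,
    mk_singleBlock_union h𝒰 (fun n => S n ∪ T n) K hK, mk_sup]
  refine congrArg (mk 𝒰) (funext fun n => ?_)
  rcases Nat.eq_zero_or_pos n with rfl | hn
  · exact eq_of_lt_two (by omega) _ _
  · have h : ((S n ∪ K n) ∩ (T n ∪ K n)).Nonempty := ⟨⟨0, hn⟩, Or.inr rfl, Or.inr rfl⟩
    rw [singleBlock_sup h, ← Set.union_union_distrib_right]

lemma mk_singleBlock_inf_mk_singleBlock (S T : ∀ n, Set (Fin n)) :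
    mk 𝒰 (fun n => singleBlock (S n)) ⊓ mk 𝒰 (fun n => singleBlock (T n)) =
      mk 𝒰 (fun n => singleBlock (S n ∩ T n)) := by
  rw [mk_singleBlock_inf]
  simp only [singleBlock_inf]

lemma isBooleanSublattice_range (h𝒰 : ∀ m : ℕ, 𝒰 ≠ pure m) :
    IsBooleanSublattice
      (Set.range fun S : ∀ n, Set (Fin n) => mk 𝒰 (fun n => singleBlock (S n))) where
  bot_mem := ⟨fun _ => ∅, by simp only [singleBlock_of_subsingleton Set.subsingleton_empty, mk_bot]⟩
  top_mem := ⟨fun _ => Set.univ, by simp only [singleBlock_univ, mk_top]⟩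
  sup_mem := by
    rintro _ ⟨S, rfl⟩ _ ⟨T, rfl⟩
    exact ⟨fun n => S n ∪ T n, (mk_singleBlock_sup h𝒰 S T).symm⟩
  inf_mem := by
    rintro _ ⟨S, rfl⟩ _ ⟨T, rfl⟩
    exact ⟨fun n => S n ∩ T n, (mk_singleBlock_inf_mk_singleBlock S T).symm⟩
  distrib := by
    rintro _ ⟨S, rfl⟩ _ ⟨T, rfl⟩ _ ⟨U, rfl⟩
    simp only [mk_singleBlock_sup h𝒰, mk_singleBlock_inf_mk_singleBlock,
      Set.inter_union_distrib_left]
  exists_compl := by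
    rintro _ ⟨S, rfl⟩
    refine ⟨_, ⟨fun n => (S n)ᶜ, rfl⟩, ?_, ?_⟩
    · simp only [mk_singleBlock_sup h𝒰, Set.union_compl_self, singleBlock_univ, mk_top]
    · simp only [mk_singleBlock_inf_mk_singleBlock, Set.inter_compl_self,
        singleBlock_of_subsingleton Set.subsingleton_empty, mk_bot]

/-! ### Metrically modular elements are one-block elements -/

/-- Elements below a partition into blocks with at most two elements are represented by sequences
below it. -/
lemma mk_inf_eq_of_le {w y : ∀ n, PartitionLattice n}
    (hy : ∀ n i j k, (y n).Rel i j → (y n).Rel i k → i = j ∨ i = k ∨ j = k)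
    (h : mk 𝒰 w ≤ mk 𝒰 y) : mk 𝒰 (fun n => w n ⊓ y n) = mk 𝒰 w := by
  have h1 := ((mk_le_iff _ _).1 h).const_mul 4
  rw [mul_zero] at h1
  refine mk_eq_mk (squeeze_zero (fun _ => dist_nonneg) (fun n => ?_) h1)
  rcases lt_or_ge n 2 with hn | hn
  · rw [eq_of_lt_two hn (w n ⊓ y n) (w n), dist_self]
    positivity
  · rw [dist_of_le inf_le_left, dist_comm, dist_of_le le_sup_right, ← mul_div_assoc]
    have h2 : ((w n ⊓ y n).numBlocks : ℝ) + 4 * (w n ⊔ y n).numBlocks ≤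
        (w n).numBlocks + 4 * (y n).numBlocks := by
      exact_mod_cast numBlocks_inf_le (hy n) (w n)
    exact div_le_div_of_nonneg_right (by linarith) (sub_one_pos hn).le

/-- Metrically modular elements are represented by partitions with one non-trivial block. -/
lemma exists_of_isMetricallyModular (h𝒰 : ∀ m : ℕ, 𝒰 ≠ pure m) {a : Ultraproduct 𝒰}
    (ha : IsMetricallyModular a) :
    ∃ S : ∀ n, Set (Fin n), mk 𝒰 (fun n => singleBlock (S n)) = a := by
  obtain ⟨x, rfl⟩ := mk_surjective a
  choose S T U D y hxS hST hxT hxU hTU hdec hy hyx hTD hD using fun n => exists_double_pairing (x n)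
  -- As x ≤ `singleBlock S` ≤ x + `singleBlock T`, it suffices that |T| = o(n).
  refine ⟨S, (mk_eq_mk_of_le h𝒰 (c := fun n => (T n).ncard) hxS
    (fun n => by exact_mod_cast numBlocks_le_add_ncard (hST n)) ?_).symm⟩
  have hTinf : mk 𝒰 (fun n => singleBlock (T n)) ⊓ mk 𝒰 x = ⊥ := by
    rw [mk_singleBlock_inf]
    simp only [inf_comm (singleBlock _), hxT, mk_bot]
  have hUinf : mk 𝒰 (fun n => singleBlock (U n)) ⊓ mk 𝒰 x = ⊥ := by
    rw [mk_singleBlock_inf]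
    simp only [inf_comm (singleBlock _), hxU, mk_bot]
  have hTUinf : mk 𝒰 (fun n => singleBlock (T n)) ⊓ mk 𝒰 (fun n => singleBlock (U n)) = ⊥ := by
    rw [mk_singleBlock_inf]
    simp only [hTU, mk_bot]
  -- A representative w of the meet is below y only in the limit. Replaced by w y, it splits into
  -- its parts in T and in U, each of which lies below [x] and a transversal of x, hence is 0.
  have hxy : mk 𝒰 x ⊓ mk 𝒰 y = ⊥ := by
    obtain ⟨w, hw⟩ := mk_surjective (mk 𝒰 x ⊓ mk 𝒰 y)
    have hwx : mk 𝒰 w ≤ mk 𝒰 x := hw ▸ inf_le_left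
    have hwy := mk_inf_eq_of_le hy (hw ▸ inf_le_right : mk 𝒰 w ≤ mk 𝒰 y)
    have h1 : ∀ V : ∀ n, Set (Fin n), mk 𝒰 (fun n => singleBlock (V n)) ⊓ mk 𝒰 x = ⊥ →
        mk 𝒰 (fun n => w n ⊓ y n ⊓ singleBlock (V n)) = ⊥ := by
      intro V hV
      rw [← le_bot_iff, ← hV]
      exact le_inf (mk_le_mk fun _ => inf_le_right)
        ((mk_le_mk fun _ => inf_le_left).trans (hwy.le.trans hwx))
    rw [← hw, ← hwy, ← le_bot_iff]
    refine (mk_le_mk fun n => hdec n (w n ⊓ y n) inf_le_right).trans ?_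
    rw [← mk_sup, h1 T hTinf, h1 U hUinf, sup_idem]
  -- Modularity gives |y| = |x + y| - |x|, and x + y = x + y T bounds this by |y T|.
  have hyT : mk 𝒰 (fun n => y n ⊓ singleBlock (T n)) = mk 𝒰 y := by
    refine eq_of_le_of_dist_le (mk_le_mk fun _ => inf_le_left) ?_
    have h1 := ha (mk 𝒰 y)
    rw [hxy, dist_self, add_zero] at h1
    have h2 : mk 𝒰 x ⊔ mk 𝒰 (fun n => y n ⊓ singleBlock (T n)) = mk 𝒰 x ⊔ mk 𝒰 y := by
      refine le_antisymm (sup_le_sup_left (mk_le_mk fun _ => inf_le_left) _)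
        (sup_le le_sup_left ?_)
      rw [mk_sup]
      exact mk_le_mk hyx
    have h3 := dist_sup_add_dist_le (bot_le : ⊥ ≤ mk 𝒰 x)
      (bot_le : ⊥ ≤ mk 𝒰 (fun n => y n ⊓ singleBlock (T n)))
    rw [h2, dist_self] at h3
    linarith
  have hyU : mk 𝒰 (fun n => y n ⊓ singleBlock (U n)) = ⊥ := by
    rw [← le_bot_iff, ← hTUinf]
    refine le_inf ?_ (mk_le_mk fun _ => inf_le_right)
    exact (mk_le_mk fun _ => inf_le_left).trans (hyT.ge.trans (mk_le_mk fun _ => inf_le_right))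
  -- Since |D| ≤ n - #(y U) and |T| ≤ 2|D| + 1, the ratio |T|/(n - 1) is at most 2|y U| + 1/(n - 1),
  -- which tends to 0.
  have h1 := tendsto_dist (𝒰 := 𝒰) (fun n => y n ⊓ singleBlock (U n)) (fun _ => ⊥)
  rw [hyU, mk_bot, dist_self] at h1
  have h2 := (h1.const_mul 2).add (tendsto_div_sub_one h𝒰 1)
  rw [mul_zero, add_zero] at h2
  refine squeeze_zero' ?_ ?_ h2
  · filter_upwards [eventually_one_le h𝒰] with n hn
    have : (1 : ℝ) ≤ n := by exact_mod_cast hn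
    exact div_nonneg (Nat.cast_nonneg _) (by linarith)
  · filter_upwards [eventually_one_le h𝒰] with n hn
    have : (1 : ℝ) ≤ n := by exact_mod_cast hn
    rw [dist_comm, dist_of_le bot_le, numBlocks_bot, ← mul_div_assoc, ← add_div]
    have e1 : ((T n).ncard : ℝ) ≤ 2 * (D n).ncard + 1 := by exact_mod_cast hTD n
    have e2 : ((y n ⊓ singleBlock (U n)).numBlocks : ℝ) + (D n).ncard ≤ n := by
      exact_mod_cast hD n
    exact div_le_div_of_nonneg_right (by linarith) (by linarith)

end Ultraproduct

theorem mainTheorem6 (𝒰 : Ultrafilter ℕ) (h𝒰 : ∀ m : ℕ, 𝒰 ≠ pure m)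
    (A : ∀ n : ℕ, Sublattice (PartitionLattice n))
    (hA : ∀ n : ℕ, Maximal IsSingularSublattice (A n) ∨
      Maximal IsSingularDistributiveSublattice (A n)) :
    IsBooleanSublattice (Ultraproduct.ofSets 𝒰 (fun n => (A n : Set (PartitionLattice n)))) ∧
    Ultraproduct.ofSets 𝒰 (fun n => (A n : Set (PartitionLattice n))) =
      {x : Ultraproduct 𝒰 | IsMetricallyModular x} := by
  rw [Ultraproduct.ofSets_eq_range h𝒰 A
    (fun n => (hA n).elim (fun h => h.prop) fun h => h.prop.1)
    fun n => PartitionLattice.exists_forall_singleBlock_mem (hA n)]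
  refine ⟨Ultraproduct.isBooleanSublattice_range h𝒰, Set.ext fun a => ⟨?_, fun ha => ?_⟩⟩
  · rintro ⟨S, rfl⟩
    exact Ultraproduct.isMetricallyModular_mk_singleBlock S
  · exact Ultraproduct.exists_of_isMetricallyModular h𝒰 ha
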